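/- Let homeomorphisms of \([0,\infty)\) act on the right, so that \(fg\) means first \(f\), then \(g\). For \(i\ge 0\) let \(x_i\) be the homeomorphism with \(tx_i=t\) for \(t\le i\), \(tx_i=i+2(t-i)\) for \(i\le t\le i+1\), and \(tx_i=t+1\) for \(t\ge i+1\), and let Thompson's group \(F\) be the group generated by all the \(x_i\). Put \(w_i=x_ix_{i+1}^{-1}\) and \(y_i=x_i^2x_{i+1}^{-1}x_i^{-1}\). For integers \(b>5\) and \(m\ge 1\), put \(\xi=b+4m+2\) and let \(X_0\) be the homeomorphism of \([0,\infty)\) that - agrees with \(x_0\) on \([0,b-2]\); - on \([b-2,b]\) is piecewise linear with \(b-2\mapsto b-1\), \(b-\frac32\mapsto b-\frac12\), \(b-1\mapsto b-\frac14\), \(b\mapsto b\), and linear in between; - agrees with \((w_b^{-2}w_{b+2}^2)(w_{b+4}^{-2}w_{b+6}^2)\cdots(w_{b+4m-4}^{-2}w_{b+4m-2}^2)\,w_{b+4m}^{-2}\) on \([b,\xi]\); - on \([\xi,\infty)\) is piecewise linear with \(\xi\mapsto\xi\), \(\xi+\frac14\mapsto\xi+1\), \(\xi+\frac12\mapsto\xi+\frac32\),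 linear in between, and \(t\mapsto t+1\) for \(t\ge \xi+\frac12\). Let \(X_1\) be \(X_0\) conjugated by translation by \(1\): \(tX_1=t\) for \(t\le 1\) and \(tX_1=(t-1)X_0+1\) for \(t\ge 1\). Let \(G\) be the group generated by \(X_0\) and \(X_1\), put \(i=m+2\), \(X_n=X_0^{1-n}X_1X_0^{n-1}\) for \(n>1\), and \[ \begin{aligned} C&=X_0^2X_1^2X_0^{-2}X_1^{-2}, & S&=X_0X_2X_1^{-2}, & T&=X_0^2X_2X_4X_3^{-2}X_1^{-1}X_0^{-1},\\ \Sigma&=C^{-i}SC^i, & \Theta&=C^{-i}TC^i, & Z&=S\Sigma S^{-1}\Sigma^{-1},\\ W&=T\Theta T^{-1}\Theta^{-1}, & P&=Z^{-1}W, & Q&=X_1^{-1}PX_1P^{-1},\\ H&=X_1^{-2}QX_1^2, & K&=X_1HX_1^{-1}. \end{aligned} \] **Proposition.** There is a \(B\) such that for all integers \(b\ge B\) with \(b>5\) and all \(m\ge 1\): (i) each of \(Z,W,P,Q,H,K\) equals the element given by the corresponding word with \(x_0,x_1\) in place of \(X_0,X_1\); (ii) \(H=w_1^{-1}\) and \(K=y_1^{-1}\);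 (iii) \(X_0\) and \(X_1\) satisfy no relation of length less than \(2m-3\), that is, no non-trivial reduced word of length less than \(2m-3\) in \(X_0^{\pm1},X_1^{\pm1}\) represents the identity; (iv) the translates of the open interval \((1,3)\) under \(G\) cover \((0,\infty)\); (v) consequently \(G=F\), that is, \(X_0\) and \(X_1\) generate \(F\). -/

import Mathlib

open scoped NNReal

namespace ThompsonF

/-- The group of self-homeomorphisms of the half line `[0, ∞)` acting on the right: in the opposite
group, `f * g` means "first `f`, then `g`". -/
abbrev RHomeo : Type := (ℝ≥0 ≃ₜ ℝ≥0)ᵐᵒᵖ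

/-- The image `t f` of a point `t` under a right acting homeomorphism `f`. -/
def RHomeo.act (f : RHomeo) (t : ℝ≥0) : ℝ≥0 := f.unop t

/-- The restriction to `[0, ∞)` of a function that is increasing and fixes `0`. -/
def restrictFun (f : ℝ → ℝ) (hm : StrictMono f) (h0 : f 0 = 0) (t : ℝ≥0) : ℝ≥0 :=
  ⟨f t, by have h := hm.monotone t.2; rwa [h0] at h⟩

theorem restrictFun_strictMono (f : ℝ → ℝ) (hm : StrictMono f) (h0 : f 0 = 0) :
    StrictMono (restrictFun f hm h0) :=
  fun a b hab => hm (show (a : ℝ) < b from hab)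

theorem restrictFun_surjective (f : ℝ → ℝ) (hm : StrictMono f) (hs : Function.Surjective f)
    (h0 : f 0 = 0) : Function.Surjective (restrictFun f hm h0) := by
  intro s
  obtain ⟨t, ht⟩ := hs s
  have h : 0 ≤ t := by
    rw [← hm.le_iff_le, h0, ht]
    exact s.2
  exact ⟨⟨t, h⟩, Subtype.ext ht⟩

/-- The right acting homeomorphism of `[0, ∞)` given by an increasing bijection of `ℝ` that
fixes `0`. -/
noncomputable def ofFun (f : ℝ → ℝ) (hm : StrictMono f) (hs : Function.Surjective f)
    (h0 : f 0 = 0) : RHomeo :=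
  MulOpposite.op ((restrictFun_strictMono f hm h0).orderIsoOfSurjective _
    (restrictFun_surjective f hm hs h0)).toHomeomorph

theorem ofFun_act (f : ℝ → ℝ) (hm : StrictMono f) (hs : Function.Surjective f) (h0 : f 0 = 0)
    (t : ℝ≥0) : ((ofFun f hm hs h0).act t : ℝ) = f t := rfl

/-! ### The standard generators -/

/-- The formula for `x_i`. -/
noncomputable def xFun (i : ℕ) (t : ℝ) : ℝ :=
  if t ≤ i then t else if t ≤ i + 1 then i + 2 * (t - i) else t + 1

theorem xFun_strictMono (i : ℕ) : StrictMono (xFun i) := by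
  intro s t h
  unfold xFun
  split_ifs <;> linarith

theorem xFun_surjective (i : ℕ) : Function.Surjective (xFun i) := by
  intro s
  rcases le_or_gt s i with h | h
  · exact ⟨s, by rw [xFun, if_pos h]⟩
  rcases le_or_gt s (i + 2) with h' | h'
  · exact ⟨i + (s - i) / 2, by unfold xFun; split_ifs <;> linarith⟩
  · exact ⟨s - 1, by unfold xFun; split_ifs <;> linarith⟩

theorem xFun_zero (i : ℕ) : xFun i 0 = 0 := by
  unfold xFun
  rw [if_pos (Nat.cast_nonneg i)]

/-- The homeomorphism `x_i` of `[0, ∞)`. -/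
noncomputable def x (i : ℕ) : RHomeo :=
  ofFun (xFun i) (xFun_strictMono i) (xFun_surjective i) (xFun_zero i)

/-- Thompson's group `F`, generated by all the `x_i`. -/
def F : Subgroup RHomeo := Subgroup.closure (Set.range x)

/-- `w_i = x_i x_{i+1}⁻¹`. -/
noncomputable def w (i : ℕ) : RHomeo := x i * (x (i + 1))⁻¹

/-- `y_i = x_i² x_{i+1}⁻¹ x_i⁻¹`. -/
noncomputable def y (i : ℕ) : RHomeo := x i ^ 2 * (x (i + 1))⁻¹ * (x i)⁻¹

/-! ### The modified generators -/

/-- The graph over `[0, 4]` of the block `w_0⁻² w_2²`, i.e. the piecewise linear function with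
vertices `(0,0), (1,1/4), (3/2,1/2), (7/4,1), (9/4,3), (5/2,7/2), (3,15/4), (4,4)`. -/
noncomputable def block (r : ℝ) : ℝ :=
  if r ≤ 1 then r / 4
  else if r ≤ 3 / 2 then r / 2 - 1 / 4
  else if r ≤ 7 / 4 then 2 * r - 5 / 2
  else if r ≤ 9 / 4 then 4 * r - 6
  else if r ≤ 5 / 2 then 2 * r - 3 / 2
  else if r ≤ 3 then r / 2 + 9 / 4
  else r / 4 + 3

/-- Copies of `block` on all the intervals `[4k, 4k+4]`, `k` an integer. -/
noncomputable def blocks (t : ℝ) : ℝ :=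
  4 * (⌊t / 4⌋ : ℝ) + block (t - 4 * (⌊t / 4⌋ : ℝ))

/-- The left end piece: slopes `1`, `1/2`, `1/4`, vertices
`(0,1), (1/2,3/2), (1,7/4), (2,2)`. -/
noncomputable def leftEnd (r : ℝ) : ℝ :=
  if r ≤ 1 / 2 then r + 1 else if r ≤ 1 then r / 2 + 5 / 4 else r / 4 + 3 / 2

/-- The right end piece: slopes `4`, `2`, `1`, vertices `(0,0), (1/4,1), (1/2,3/2)`, and translation
by `1` from there on. -/
noncomputable def rightEnd (r : ℝ) : ℝ :=
  if r ≤ 1 / 4 then 4 * r else if r ≤ 1 / 2 then 2 * r + 1 / 2 else r + 1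

/-- The formula for `X_0`: it is `x_0` on `[0, b-2]`, the left end piece on `[b-2, b]`, then
`m` and a half copies of the block on `[b, b+4m+2]` (that is,
`(w_b⁻² w_{b+2}²) ⋯ (w_{b+4m-4}⁻² w_{b+4m-2}²) w_{b+4m}⁻²`), and the right end
piece on `[b+4m+2, ∞)`, which is translation by `1` on `[b+4m+3, ∞)`. -/
noncomputable def X0Fun (b m : ℕ) (t : ℝ) : ℝ :=
  if t ≤ b - 2 then xFun 0 t
  else if t ≤ b then (b - 2) + leftEnd (t - (b - 2))
  else if t ≤ b + 4 * m + 2 then b + blocks (t - b)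
  else (b + 4 * m + 2) + rightEnd (t - (b + 4 * m + 2))

/-- The formula for `X_1`: the conjugate of `X_0` by translation by `1`; it is the identity
on `[0, 1]`. -/
noncomputable def X1Fun (b m : ℕ) (t : ℝ) : ℝ := X0Fun b m (t - 1) + 1

theorem block_strictMono : StrictMono block := by
  intro s t h
  unfold block
  split_ifs <;> linarith

theorem block_zero : block 0 = 0 := by norm_num [block]

theorem block_four : block 4 = 4 := by norm_num [block]

theorem block_surjective : Function.Surjective block := by
  intro s
  unfold block
  rcases le_or_gt s (1 / 4) with h1 | h1
  · exact ⟨4 * s, by split_ifs <;> linarith⟩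
  rcases le_or_gt s (1 / 2) with h2 | h2
  · exact ⟨2 * s + 1 / 2, by split_ifs <;> linarith⟩
  rcases le_or_gt s 1 with h3 | h3
  · exact ⟨s / 2 + 5 / 4, by split_ifs <;> linarith⟩
  rcases le_or_gt s 3 with h4 | h4
  · exact ⟨s / 4 + 3 / 2, by split_ifs <;> linarith⟩
  rcases le_or_gt s (7 / 2) with h5 | h5
  · exact ⟨s / 2 + 3 / 4, by split_ifs <;> linarith⟩
  rcases le_or_gt s (15 / 4) with h6 | h6
  · exact ⟨2 * s - 9 / 2, by split_ifs <;> linarith⟩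
  · exact ⟨4 * s - 12, by split_ifs <;> linarith⟩

theorem blocks_eq {k : ℤ} {t : ℝ} (h : 4 * (k : ℝ) ≤ t) (h' : t < 4 * k + 4) :
    blocks t = 4 * k + block (t - 4 * k) := by
  have hk : ⌊t / 4⌋ = k := by
    rw [Int.floor_eq_iff]
    constructor <;> linarith
  rw [blocks, hk]

theorem exists_block (t : ℝ) : ∃ k : ℤ, 4 * (k : ℝ) ≤ t ∧ t < 4 * k + 4 :=
  ⟨⌊t / 4⌋, by linarith [Int.floor_le (t / 4)], by linarith [Int.lt_floor_add_one (t / 4)]⟩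

theorem blocks_strictMono : StrictMono blocks := by
  intro s t h
  obtain ⟨k, hk, hk'⟩ := exists_block s
  obtain ⟨l, hl, hl'⟩ := exists_block t
  rw [blocks_eq hk hk', blocks_eq hl hl']
  have hkl : k < l + 1 := by
    have : (k : ℝ) < l + 1 := by linarith
    exact_mod_cast this
  rcases (Int.lt_add_one_iff.mp hkl).eq_or_lt with rfl | hlt
  · have := block_strictMono (show s - 4 * (k : ℝ) < t - 4 * k by linarith)
    linarith
  · have h1 : (k : ℝ) + 1 ≤ l := by exact_mod_cast hlt
    have h2 := block_strictMono (show s - 4 * (k : ℝ) < 4 by linarith)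
    have h3 := block_strictMono.monotone (show 0 ≤ t - 4 * (l : ℝ) by linarith)
    rw [block_four] at h2
    rw [block_zero] at h3
    linarith

theorem blocks_surjective : Function.Surjective blocks := by
  intro s
  obtain ⟨k, hk, hk'⟩ := exists_block s
  obtain ⟨r, hr⟩ := block_surjective (s - 4 * k)
  have h1 : 0 ≤ r := by
    rw [← block_strictMono.le_iff_le, block_zero, hr]
    linarith
  have h2 : r < 4 := by
    rw [← block_strictMono.lt_iff_lt, block_four, hr]
    linarith
  refine ⟨4 * k + r, ?_⟩
  rw [blocks_eq (k := k) (by linarith) (by linarith), add_sub_cancel_left, hr]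
  ring

theorem blocks_zero : blocks 0 = 0 := by
  rw [blocks_eq (k := 0) (by norm_num) (by norm_num)]
  norm_num [block]

theorem blocks_end (m : ℕ) : blocks (4 * m + 2) = 4 * m + 2 := by
  rw [blocks_eq (k := m) (by push_cast; linarith) (by push_cast; linarith)]
  norm_num [block]

theorem leftEnd_strictMono : StrictMono leftEnd := by
  intro s t h
  unfold leftEnd
  split_ifs <;> linarith

theorem rightEnd_strictMono : StrictMono rightEnd := by
  intro s t h
  unfold rightEnd
  split_ifs <;> linarith

theorem leftEnd_two : leftEnd 2 = 2 := by norm_num [leftEnd]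

theorem leftEnd_zero : leftEnd 0 = 1 := by norm_num [leftEnd]

theorem rightEnd_zero : rightEnd 0 = 0 := by norm_num [rightEnd]

theorem X0Fun_strictMono {b : ℕ} (m : ℕ) (hb : 5 < b) : StrictMono (X0Fun b m) := by
  have hb' : (6 : ℝ) ≤ b := by exact_mod_cast hb
  have hm : (0 : ℝ) ≤ m := Nat.cast_nonneg m
  have ex : xFun 0 (b - 2) = b - 1 := by
    unfold xFun
    push_cast
    split_ifs <;> linarith
  have eL := leftEnd_two
  have eL0 := leftEnd_zero
  have eP := blocks_zero
  have eP' := blocks_end m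
  have eR := rightEnd_zero
  intro s t h
  unfold X0Fun
  have a1 : ∀ u : ℝ, u ≤ b - 2 → xFun 0 u ≤ b - 1 :=
    fun u hu => ex ▸ (xFun_strictMono 0).monotone hu
  have a2 : ∀ u : ℝ, b - 2 < u → 1 < leftEnd (u - (b - 2)) :=
    fun u hu => eL0 ▸ leftEnd_strictMono (by linarith)
  have a3 : ∀ u : ℝ, u ≤ b → leftEnd (u - (b - 2)) ≤ 2 := fun u hu => by
    have := leftEnd_strictMono.monotone (show u - (b - 2) ≤ 2 by linarith)
    linarith
  have a4 : ∀ u : ℝ, b < u → 0 < blocks (u - b) := fun u hu => by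
    have := blocks_strictMono (show 0 < u - b by linarith)
    linarith
  have a5 : ∀ u : ℝ, u ≤ b + 4 * m + 2 → blocks (u - b) ≤ 4 * m + 2 := fun u hu => by
    have := blocks_strictMono.monotone (show u - b ≤ 4 * m + 2 by linarith)
    linarith
  have a6 : ∀ u : ℝ, b + 4 * m + 2 < u → 0 < rightEnd (u - (b + 4 * m + 2)) := fun u hu => by
    have := rightEnd_strictMono (show 0 < u - (b + 4 * m + 2) by linarith)
    linarith
  have b1 := xFun_strictMono 0 h
  have b2 := leftEnd_strictMono (show s - (b - 2) < t - (b - 2) by linarith)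
  have b3 := blocks_strictMono (show s - b < t - b by linarith)
  have b4 := rightEnd_strictMono
    (show s - (b + 4 * m + 2) < t - (b + 4 * m + 2) by linarith)
  split_ifs with h1 h2 h3 h4 h5 h6 h7 h8 h9 h10 h11 h12 <;>
    first
    | linarith
    | (simp only [not_le] at *
       linarith [a1 s (by linarith), a2 t (by linarith)])
    | (simp only [not_le] at *
       linarith [a1 s (by linarith), a4 t (by linarith)])
    | (simp only [not_le] at *
       linarith [a1 s (by linarith), a6 t (by linarith)])
    | (simp only [not_le] at *
       linarith [a3 s (by linarith), a4 t (by linarith)])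
    | (simp only [not_le] at *
       linarith [a3 s (by linarith), a6 t (by linarith)])
    | (simp only [not_le] at *
       linarith [a5 s (by linarith), a6 t (by linarith)])

theorem X0Fun_surjective {b : ℕ} (m : ℕ) (hb : 5 < b) : Function.Surjective (X0Fun b m) := by
  have hb' : (6 : ℝ) ≤ b := by exact_mod_cast hb
  have hm : (0 : ℝ) ≤ m := Nat.cast_nonneg m
  intro s
  unfold X0Fun
  rcases le_or_gt s (b - 1) with h1 | h1
  · obtain ⟨t, ht⟩ := xFun_surjective 0 s
    have h : t ≤ b - 2 := by
      by_contra! hc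
      have := xFun_strictMono 0 hc
      have ex : xFun 0 (b - 2) = b - 1 := by
        unfold xFun
        push_cast
        split_ifs <;> linarith
      linarith
    exact ⟨t, by rw [if_pos h, ht]⟩
  rcases le_or_gt s b with h2 | h2
  · have key : ∃ r, 0 < r ∧ r ≤ 2 ∧ leftEnd r = s - (b - 2) := by
      unfold leftEnd
      rcases le_or_gt (s - (b - 2)) (3 / 2) with h3 | h3
      · exact ⟨s - (b - 2) - 1, by linarith, by linarith, by split_ifs <;> linarith⟩
      rcases le_or_gt (s - (b - 2)) (7 / 4) with h4 | h4
      · exact ⟨2 * (s - (b - 2)) - 5 / 2, by linarith, by linarith, by split_ifs <;> linarith⟩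
      · exact ⟨4 * (s - (b - 2)) - 6, by linarith, by linarith, by split_ifs <;> linarith⟩
    obtain ⟨r, hr0, hr2, hr⟩ := key
    refine ⟨(b - 2) + r, ?_⟩
    rw [if_neg (by linarith), if_pos (by linarith), add_sub_cancel_left, hr]
    ring
  rcases le_or_gt s (b + 4 * m + 2) with h3 | h3
  · obtain ⟨r, hr⟩ := blocks_surjective (s - b)
    have hr0 : 0 < r := by
      rw [← blocks_strictMono.lt_iff_lt, blocks_zero, hr]
      linarith
    have hr1 : r ≤ 4 * m + 2 := by
      rw [← blocks_strictMono.le_iff_le, blocks_end, hr]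
      linarith
    refine ⟨b + r, ?_⟩
    rw [if_neg (by linarith), if_neg (by linarith), if_pos (by linarith), add_sub_cancel_left, hr]
    ring
  · have key : ∃ r, 0 < r ∧ rightEnd r = s - (b + 4 * m + 2) := by
      unfold rightEnd
      rcases le_or_gt (s - (b + 4 * m + 2)) 1 with h4 | h4
      · exact ⟨(s - (b + 4 * m + 2)) / 4, by linarith, by split_ifs <;> linarith⟩
      rcases le_or_gt (s - (b + 4 * m + 2)) (3 / 2) with h5 | h5
      · exact ⟨(s - (b + 4 * m + 2)) / 2 - 1 / 4, by linarith, by split_ifs <;> linarith⟩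
      · exact ⟨s - (b + 4 * m + 2) - 1, by linarith, by split_ifs <;> linarith⟩
    obtain ⟨r, hr0, hr⟩ := key
    refine ⟨(b + 4 * m + 2) + r, ?_⟩
    rw [if_neg (by linarith), if_neg (by linarith), if_neg (by linarith), add_sub_cancel_left, hr]
    ring

theorem X0Fun_zero {b : ℕ} (m : ℕ) (hb : 5 < b) : X0Fun b m 0 = 0 := by
  have hb' : (6 : ℝ) ≤ b := by exact_mod_cast hb
  rw [X0Fun, if_pos (by linarith), xFun_zero]

theorem X1Fun_strictMono {b : ℕ} (m : ℕ) (hb : 5 < b) : StrictMono (X1Fun b m) := by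
  intro s t h
  have := X0Fun_strictMono m hb (show s - 1 < t - 1 by linarith)
  unfold X1Fun
  linarith

theorem X1Fun_surjective {b : ℕ} (m : ℕ) (hb : 5 < b) : Function.Surjective (X1Fun b m) := by
  intro s
  obtain ⟨t, ht⟩ := X0Fun_surjective m hb (s - 1)
  exact ⟨t + 1, by rw [X1Fun, add_sub_cancel_right, ht, sub_add_cancel]⟩

theorem X1Fun_zero {b : ℕ} (m : ℕ) (hb : 5 < b) : X1Fun b m 0 = 0 := by
  have hb' : (6 : ℝ) ≤ b := by exact_mod_cast hb
  rw [X1Fun, X0Fun, if_pos (by linarith), xFun, if_pos (by norm_num)]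
  norm_num

/-- The homeomorphism `X_0` of `[0, ∞)`. -/
noncomputable def X0 (b m : ℕ) (hb : 5 < b) : RHomeo :=
  ofFun (X0Fun b m) (X0Fun_strictMono m hb) (X0Fun_surjective m hb) (X0Fun_zero m hb)

/-- The homeomorphism `X_1` of `[0, ∞)`. -/
noncomputable def X1 (b m : ℕ) (hb : 5 < b) : RHomeo :=
  ofFun (X1Fun b m) (X1Fun_strictMono m hb) (X1Fun_surjective m hb) (X1Fun_zero m hb)

/-- The subgroup `G` generated by `X_0` and `X_1`. -/
noncomputable def G (b m : ℕ) (hb : 5 < b) : Subgroup RHomeo :=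
  Subgroup.closure {X0 b m hb, X1 b m hb}

/-! ### The words

Each word is defined in an arbitrary group, in terms of two elements `a₀` and `a₁`; the upper case
symbols are the values at `X_0, X_1`, the lower case ones are the values at `x_0, x_1`. -/

namespace Word

variable {G : Type*} [Group G] (a₀ a₁ : G)

/-- `a_0`, `a_1`, and `a_n = a_0^{1-n} a_1 a_0^{n-1}` for `n > 1`. -/
def gen : ℕ → G
  | 0 => a₀
  | n + 1 => (a₀ ^ n)⁻¹ * a₁ * a₀ ^ n

def C : G := a₀ ^ 2 * a₁ ^ 2 * (a₀ ^ 2)⁻¹ * (a₁ ^ 2)⁻¹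

def S : G := a₀ * gen a₀ a₁ 2 * (a₁ ^ 2)⁻¹

def T : G :=
  a₀ ^ 2 * gen a₀ a₁ 2 * gen a₀ a₁ 4 * (gen a₀ a₁ 3 ^ 2)⁻¹ * a₁⁻¹ * a₀⁻¹

/-- `Σ = C⁻ⁱ S Cⁱ`. -/
def Sig (i : ℕ) : G := (C a₀ a₁ ^ i)⁻¹ * S a₀ a₁ * C a₀ a₁ ^ i

/-- `Θ = C⁻ⁱ T Cⁱ`. -/
def Theta (i : ℕ) : G := (C a₀ a₁ ^ i)⁻¹ * T a₀ a₁ * C a₀ a₁ ^ i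

def Z (i : ℕ) : G :=
  S a₀ a₁ * Sig a₀ a₁ i * (S a₀ a₁)⁻¹ * (Sig a₀ a₁ i)⁻¹

def W (i : ℕ) : G :=
  T a₀ a₁ * Theta a₀ a₁ i * (T a₀ a₁)⁻¹ * (Theta a₀ a₁ i)⁻¹

def P (i : ℕ) : G := (Z a₀ a₁ i)⁻¹ * W a₀ a₁ i

def Q (i : ℕ) : G := a₁⁻¹ * P a₀ a₁ i * a₁ * (P a₀ a₁ i)⁻¹

def H (i : ℕ) : G := (a₁ ^ 2)⁻¹ * Q a₀ a₁ i * a₁ ^ 2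

def K (i : ℕ) : G := a₁ * H a₀ a₁ i * a₁⁻¹

end Word

end ThompsonF

namespace ThompsonF

/-! `X_0` and `X_1` agree with `x_0` and `x_1` near `0`, but in the middle region they have long
rows of alternately attracting and repelling fixed points, those of `X_0` in `b + 2ℤ` and those of
`X_1` in `b + 1 + 2ℤ`. The letters `X_0, X_1, X_0⁻¹, X_1⁻¹` attract towards the residues `0, 1, 2,
3` modulo `4`, relative to `b`.

No short relations: this is ping-pong with room for finitely many moves. Each letter of a reduced
word carries a point near an integer to a point near one of its own attracting points at distance at
most `1` from that integer, and only the inverse letter repels from there (`exists_sends_word`). A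
start in the middle whose residue differs from that of the last attractor is not returned to.

The words: `S` and its conjugate `T` fix every point of the two ranges where both generators act as
translations, so their supports have a part near `0` and a part in the middle region. The element
`C` climbs past one block of length `4` at each step, hence `C ^ (m + 2)` carries the left end of
the middle part beyond its right end. The commutators `Z` and `W` therefore lose the middle part and
equal their values at `x_0, x_1` (`commutator_X_eq`); `P, Q, H, K` inherit this because conjugation
of an element supported near `0` only sees the conjugator there. At the standard generators, `Z` and
`W` are `S` and `T` up to elements with tiny support at `0` (`exists_P_x_eq`); the last conjugations
by `x_1` remove these, and the relations of `F` yield `w_1⁻¹` and `y_1⁻¹`.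

Generation: `G ≤ F` follows from a factorization of `X_0` (`X0_eq`) and invariance of `F` under
translation. Conversely, `w_1, y_1 ∈ G`, and conjugation by `X_0` produces enough `w_i, y_i` to
generate all elements of `F` supported in `[2, 6]` (`mem_of_w_mem_of_fixedOn`). Two elements of `G`
that fix `2` and have no common fixed point in `[6, ∞)` push the right endpoint of this interval
arbitrarily far (`eq_univ_of_sends`, `mem_G_of_fixedOn`). Then `x_0 X_0⁻¹` and `x_1 X_1⁻¹`, whose
supports are bounded and to the right of `2`, lie in `G`. The same supremum argument gives the
covering by translates of `(1, 3)`. -/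

/-! ### The graph of a homeomorphism as a relation between reals -/

/-- `Sends f a b` says that `a ≥ 0` and that `f` maps `a` to `b`. -/
def Sends (f : RHomeo) (a b : ℝ) : Prop := ∃ t : ℝ≥0, (t : ℝ) = a ∧ (f.act t : ℝ) = b

theorem act_one (t : ℝ≥0) : RHomeo.act 1 t = t := rfl

theorem act_mul (f g : RHomeo) (t : ℝ≥0) : RHomeo.act (f * g) t = g.act (f.act t) := rfl

theorem act_inv_act (f : RHomeo) (t : ℝ≥0) : RHomeo.act f⁻¹ (f.act t) = t := by
  rw [← act_mul, mul_inv_cancel, act_one]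

theorem act_act_inv (f : RHomeo) (t : ℝ≥0) : f.act (RHomeo.act f⁻¹ t) = t := by
  rw [← act_mul, inv_mul_cancel, act_one]

theorem act_injective (f : RHomeo) : Function.Injective f.act :=
  Function.LeftInverse.injective (act_inv_act f)

theorem ext_act {f g : RHomeo} (h : ∀ t, f.act t = g.act t) : f = g :=
  MulOpposite.unop_injective (Homeomorph.ext h)

theorem sends_act (f : RHomeo) (t : ℝ≥0) : Sends f t (f.act t)  := ⟨t, rfl, rfl⟩

namespace Sends

variable {f g : RHomeo} {a b c : ℝ}

theorem nonneg (h : Sends f a b) : 0 ≤ a := by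
  obtain ⟨_, rfl, _⟩ := h
  exact NNReal.coe_nonneg _

theorem nonneg' (h : Sends f a b) : 0 ≤ b := by
  obtain ⟨_, _, rfl⟩ := h
  exact NNReal.coe_nonneg _

theorem unique (h : Sends f a b) (h' : Sends f a c) : b = c := by
  obtain ⟨t, rfl, rfl⟩ := h
  obtain ⟨u, hu, rfl⟩ := h'
  rw [NNReal.coe_injective hu]

theorem inj (h : Sends f a c) (h' : Sends f b c) : a = b := by
  obtain ⟨t, rfl, rfl⟩ := h
  obtain ⟨u, rfl, hu⟩ := h'
  rw [act_injective f (NNReal.coe_injective hu)]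

theorem mul (h : Sends f a b) (h' : Sends g b c) : Sends (f * g) a c := by
  obtain ⟨t, rfl, rfl⟩ := h
  obtain ⟨u, hu, rfl⟩ := h'
  refine ⟨t, rfl, ?_⟩
  rw [act_mul, NNReal.coe_injective hu]

theorem inv (h : Sends f a b) : Sends f⁻¹ b a := by
  obtain ⟨t, rfl, rfl⟩ := h
  exact ⟨f.act t, rfl, by rw [act_inv_act]⟩

theorem congr {b' : ℝ} (h : Sends f a b) (hb : b = b') : Sends f a b' := hb ▸ h

theorem sq (h : Sends f a b) (h' : Sends f b c) : Sends (f ^ 2) a c := by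
  rw [pow_two]
  exact h.mul h'

theorem inv_sq (h : Sends f b a) (h' : Sends f c b) : Sends (f ^ 2)⁻¹ a c := (h'.sq h).inv

end Sends

theorem sends_one {a : ℝ} (ha : 0 ≤ a) : Sends 1 a a := ⟨⟨a, ha⟩, rfl, rfl⟩

theorem exists_sends (f : RHomeo) {a : ℝ} (ha : 0 ≤ a) : ∃ b, Sends f a b :=
  ⟨_, ⟨a, ha⟩, rfl, rfl⟩

theorem exists_sends_to (f : RHomeo) {b : ℝ} (hb : 0 ≤ b) : ∃ a, Sends f a b := by
  obtain ⟨a, h⟩ := exists_sends f⁻¹ hb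
  exact ⟨a, by simpa using h.inv⟩

theorem ext_sends {f g : RHomeo} (h : ∀ a b, Sends f a b → Sends g a b) : f = g :=
  ext_act fun t => Subtype.ext (((h _ _ (sends_act f t)).unique (sends_act g t)))

/-- The homeomorphisms that fix every point of `s`. -/
def fixedOn (s : Set ℝ) : Subgroup RHomeo where
  carrier := {f | ∀ a ∈ s, 0 ≤ a → Sends f a a}
  mul_mem' hf hg a ha h0 := (hf a ha h0).mul (hg a ha h0)
  one_mem' _ _ h0 := sends_one h0
  inv_mem' hf a ha h0 := (hf a ha h0).inv

theorem fixedOn_anti {s t : Set ℝ} (h : s ⊆ t) : fixedOn t ≤ fixedOn s :=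
  fun _ hf a ha => hf a (h ha)

/-- Disjoint supports: each of the two maps preserves the side of `a` on which the other is trivial.
-/
theorem commute_of_fixedOn {f g : RHomeo} {a : ℝ} (hf : f ∈ fixedOn (Set.Iic a))
    (hg : g ∈ fixedOn (Set.Ici a)) : Commute f g := by
  refine ext_sends fun t u h => ?_
  rcases le_total t a with hta | hta
  · obtain ⟨v, hv⟩ := exists_sends g h.nonneg
    have hva : v ≤ a := by
      by_contra! hc
      have := hv.inj (hg v hc.le hv.nonneg')
      linarith
    rw [h.unique ((hf t hta h.nonneg).mul hv)]
    exact hv.mul (hf v hva hv.nonneg')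
  · obtain ⟨v, hv⟩ := exists_sends f h.nonneg
    have hva : a ≤ v := by
      by_contra! hc
      have := hv.inj (hf v hc.le hv.nonneg')
      linarith
    rw [h.unique (hv.mul (hg v hva hv.nonneg'))]
    exact (hg t hta h.nonneg).mul hv

/-- Conjugating a homeomorphism that fixes `[a, ∞)` only depends on the conjugator on `[0, a]`. -/
theorem conj_eq_of_fixedOn {f A A' : RHomeo} {a : ℝ} (hf : f ∈ fixedOn (Set.Ici a))
    (hA : ∀ t u, t ≤ a → Sends A t u → Sends A' t u) : A⁻¹ * f * A = A'⁻¹ * f * A' := by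
  have h : A' * A⁻¹ ∈ fixedOn (Set.Iic a) := fun t hta h0 => by
    obtain ⟨u, hu⟩ := exists_sends A h0
    exact (hA t u hta hu).mul hu.inv
  have e := (commute_of_fixedOn h hf).eq
  calc A⁻¹ * f * A = A'⁻¹ * ((A' * A⁻¹) * f) * A := by group
    _ = A'⁻¹ * f * A' := by rw [e]; group

/-! ### Increasing homeomorphisms -/

/-- The increasing homeomorphisms. -/
def increasing : Subgroup RHomeo where
  carrier := {f | StrictMono f.act}
  mul_mem' hf hg := hg.comp hf
  one_mem' := strictMono_id
  inv_mem' {f} hf a b hab := by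
    have hf : StrictMono f.act := hf
    rwa [← hf.lt_iff_lt, act_act_inv, act_act_inv]

theorem Sends.lt_iff {f : RHomeo} (hf : f ∈ increasing) {a b a' b' : ℝ} (h : Sends f a b)
    (h' : Sends f a' b') : a < a' ↔ b < b' := by
  obtain ⟨t, rfl, rfl⟩ := h
  obtain ⟨u, rfl, rfl⟩ := h'
  have hf : StrictMono f.act := hf
  rw [NNReal.coe_lt_coe, NNReal.coe_lt_coe, hf.lt_iff_lt]

theorem Sends.le_iff {f : RHomeo} (hf : f ∈ increasing) {a b a' b' : ℝ} (h : Sends f a b)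
    (h' : Sends f a' b') : a ≤ a' ↔ b ≤ b' := by
  rw [← not_lt, ← not_lt, h'.lt_iff hf h]

theorem ofFun_increasing (f : ℝ → ℝ) (hm : StrictMono f) (hs : Function.Surjective f)
    (h0 : f 0 = 0) : ofFun f hm hs h0 ∈ increasing :=
  restrictFun_strictMono f hm h0

theorem sends_ofFun {f : ℝ → ℝ} (hm : StrictMono f) (hs : Function.Surjective f)
    (h0 : f 0 = 0) {t u : ℝ} (ht : 0 ≤ t) (hu : f t = u) : Sends (ofFun f hm hs h0) t u :=
  ⟨⟨t, ht⟩, rfl, hu⟩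

theorem lt_of_sends_pow {f : RHomeo} (hf : f ∈ increasing) {t u : ℝ} (h : Sends f t u)
    (htu : t < u) (n : ℕ) {v : ℝ} (hv : Sends (f ^ (n + 1)) t v) : t < v := by
  induction n generalizing v with
  | zero =>
    rw [zero_add, pow_one] at hv
    rwa [← h.unique hv]
  | succ n ih =>
    obtain ⟨z, hz⟩ := exists_sends (f ^ (n + 1)) h.nonneg
    rw [pow_succ] at hv
    obtain ⟨y, hy⟩ := exists_sends f hz.nonneg'
    rw [hv.unique (hz.mul hy)]
    exact htu.trans ((h.lt_iff hf hy).1 (ih hz))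

/-- An increasing map has no periodic points other than fixed points. This is what later forces an
unknown exponent to vanish. -/
theorem eq_zero_of_sends_zpow {f : RHomeo} (hf : f ∈ increasing) {t u : ℝ} (h : Sends f t u)
    (htu : t < u) {e : ℤ} (he : Sends (f ^ e) t t) : e = 0 := by
  rcases lt_trichotomy e 0 with h0 | h0 | h0
  · obtain ⟨n, hn⟩ := Int.eq_succ_of_zero_lt (neg_pos.2 h0)
    have h1 := he.inv
    rw [← zpow_neg, hn, ← Nat.cast_succ, zpow_natCast] at h1
    exact absurd (lt_of_sends_pow hf h htu n h1) (lt_irrefl _)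
  · exact h0
  · obtain ⟨n, hn⟩ := Int.eq_succ_of_zero_lt h0
    rw [hn, ← Nat.cast_succ, zpow_natCast] at he
    exact absurd (lt_of_sends_pow hf h htu n he) (lt_irrefl _)

/-! ### The standard generators -/

theorem sends_x_low {i : ℕ} {t : ℝ} (h0 : 0 ≤ t) (h : t ≤ i) : Sends (x i) t t :=
  sends_ofFun _ _ _ h0 (by rw [xFun, if_pos h])

theorem sends_x_mid {i : ℕ} {t u : ℝ} (h : i ≤ t) (h' : t ≤ i + 1) (hu : u = i + 2 * (t - i)) :
    Sends (x i) t u :=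
  sends_ofFun _ _ _ ((Nat.cast_nonneg i).trans h) (by unfold xFun; split_ifs <;> linarith)

theorem sends_x_high {i : ℕ} {t u : ℝ} (h : i + 1 ≤ t) (hu : u = t + 1) : Sends (x i) t u :=
  sends_ofFun _ _ _ (by have : (0 : ℝ) ≤ i := Nat.cast_nonneg i
                        linarith) (by unfold xFun; split_ifs <;> linarith)

theorem sends_x (i : ℕ) {t : ℝ} (h : 0 ≤ t) : Sends (x i) t (xFun i t) :=
  sends_ofFun _ _ _ h rfl

theorem x_increasing (i : ℕ) : x i ∈ increasing := ofFun_increasing _ _ _ _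

theorem x_fixedOn (i : ℕ) : x i ∈ fixedOn (Set.Iic (i : ℝ)) := fun _ h h0 => sends_x_low h0 h

theorem F_le_increasing : F ≤ increasing := by
  rw [F, Subgroup.closure_le]
  rintro _ ⟨i, rfl⟩
  exact x_increasing i

theorem x_mem_F (i : ℕ) : x i ∈ F := Subgroup.subset_closure ⟨i, rfl⟩

theorem w_mem_F (i : ℕ) : w i ∈ F := mul_mem (x_mem_F _) (inv_mem (x_mem_F _))

theorem y_mem_F (i : ℕ) : y i ∈ F :=
  mul_mem (mul_mem (pow_mem (x_mem_F _) 2) (inv_mem (x_mem_F _))) (inv_mem (x_mem_F _))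

theorem x_mul_x {i j : ℕ} (h : i < j) : x j * x i = x i * x (j + 1) := by
  refine ext_sends fun t u hu => ?_
  have hj := sends_x j hu.nonneg
  have hi := sends_x i hu.nonneg
  have h1 := hj.mul (sends_x i hj.nonneg')
  have h2 := hi.mul (sends_x (j + 1) hi.nonneg')
  rw [hu.unique h1]
  refine h2.congr ?_
  have hij : (i : ℝ) + 1 ≤ j := by exact_mod_cast h
  unfold xFun
  push_cast
  split_ifs <;> linarith

theorem conj_x {i j : ℕ} (h : i < j) : (x i)⁻¹ * x j * x i = x (j + 1) := by
  rw [mul_assoc, x_mul_x h, inv_mul_cancel_left]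

theorem conj_w {i j : ℕ} (h : i < j) : (x i)⁻¹ * w j * x i = w (j + 1) := by
  rw [w, w, ← conj_x (show i < j + 1 by omega), ← conj_x h]
  simp only [mul_inv_rev, inv_inv, mul_assoc, mul_inv_cancel_left]

theorem y_eq (i : ℕ) : y i = x i * w i * (x i)⁻¹ := by
  rw [y, w, pow_two]
  group

theorem conj_y {i j : ℕ} (h : i < j) : (x i)⁻¹ * y j * x i = y (j + 1) := by
  rw [y_eq, y_eq, ← conj_w h, ← conj_x h]
  group

/-- The formula for `w_i`, relative to the point `i`. -/
noncomputable def wFun (r : ℝ) : ℝ :=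
  if r ≤ 0 then r else if r ≤ 1 / 2 then 2 * r else if r ≤ 1 then r + 1 / 2
  else if r ≤ 2 then r / 2 + 1 else r

theorem sends_w (i : ℕ) {t : ℝ} (h : 0 ≤ t) : Sends (w i) t (i + wFun (t - i)) := by
  have h1 := sends_x i h
  have h2 : Sends (x (i + 1)) (i + wFun (t - i)) (xFun i t) := by
    have hi : (0 : ℝ) ≤ i := Nat.cast_nonneg i
    refine sends_ofFun _ _ _ ?_ ?_
    · unfold wFun
      split_ifs <;> linarith
    · unfold wFun xFun
      push_cast
      split_ifs <;> linarith
  exact h1.mul h2.inv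

theorem w_fixedOn_Iic (i : ℕ) : w i ∈ fixedOn (Set.Iic (i : ℝ)) := fun t (h : t ≤ i) h0 =>
  (sends_w i h0).congr (by unfold wFun; rw [if_pos (by linarith)]; ring)

theorem w_fixedOn_Ici (i : ℕ) : w i ∈ fixedOn (Set.Ici ((i : ℝ) + 2)) :=
  fun t (h : (i : ℝ) + 2 ≤ t) h0 =>
    (sends_w i h0).congr (by unfold wFun; split_ifs <;> linarith)

theorem y_fixedOn_Ici (i : ℕ) : y i ∈ fixedOn (Set.Ici ((i : ℝ) + 1)) := by
  intro t (h : (i : ℝ) + 1 ≤ t) h0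
  have hx : Sends (x i) t (t + 1) := sends_x_high h rfl
  rw [y_eq]
  exact (hx.mul (w_fixedOn_Ici i _ (show (i : ℝ) + 2 ≤ t + 1 by linarith) (by linarith))).mul hx.inv

theorem y_fixedOn_Iic (i : ℕ) : y i ∈ fixedOn (Set.Iic (i : ℝ)) := by
  rw [y_eq]
  exact mul_mem (mul_mem (x_fixedOn i) (w_fixedOn_Iic i)) (inv_mem (x_fixedOn i))

/-! ### The words `C`, `S`, `T` -/

namespace Word

section Group

variable {G : Type*} [Group G] (a₀ a₁ : G)

theorem S_eq : S a₀ a₁ = a₁ * a₀ * (a₁ ^ 2)⁻¹ := by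
  simp only [S, gen]
  group

theorem T_eq : T a₀ a₁ =
    (a₀ * a₁ * (a₀ ^ 2)⁻¹) * S a₀ a₁ * (a₀ * a₁ * (a₀ ^ 2)⁻¹)⁻¹ := by
  have h : ((a₀ ^ 2)⁻¹ * a₁ * a₀ ^ 2) ^ 2 = (a₀ ^ 2)⁻¹ * a₁ ^ 2 * a₀ ^ 2 := by
    simpa using conj_pow (a := (a₀ ^ 2)⁻¹) (b := a₁) (i := 2)
  simp only [T, S, gen, h]
  group

/-- A consequence of the relations `x_j x_i = x_i x_{j+1}` for `i < j` between consecutive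
generators. -/
theorem conj_of_relations {a b c d : G} (hab : b * a = a * c) (hbc : c * b = b * d) :
    (b ^ 2 * c⁻¹ * b * d * (c ^ 2)⁻¹ * a⁻¹) * b * (b ^ 2 * c⁻¹ * b * d * (c ^ 2)⁻¹ * a⁻¹)⁻¹ =
      b ^ 3 * c * (b ^ 3)⁻¹ := by
  have h1 : a⁻¹ * b * a = c := by rw [mul_assoc, hab, inv_mul_cancel_left]
  have h2 : b * d * c * d⁻¹ * b⁻¹ = c * b * c * (c * b)⁻¹ := by
    rw [← hbc, mul_assoc _ d⁻¹, ← mul_inv_rev, ← hbc]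
  calc _ = b ^ 2 * c⁻¹ * b * d * (c ^ 2)⁻¹ * (a⁻¹ * b * a) * c ^ 2 * d⁻¹ * b⁻¹ * c * (b ^ 2)⁻¹ := by
        group
    _ = b ^ 2 * c⁻¹ * (b * d * c * d⁻¹ * b⁻¹) * c * (b ^ 2)⁻¹ := by rw [h1]; group
    _ = _ := by rw [h2]; group

end Group

variable {A B : RHomeo}

theorem sends_C {a b c d e f g h i : ℝ} (h1 : Sends A a b) (h2 : Sends A b c) (h3 : Sends B c d)
    (h4 : Sends B d e) (h5 : Sends A f e) (h6 : Sends A g f) (h7 : Sends B h g)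
    (h8 : Sends B i h) : Sends (C A B) a i :=
  (((h1.sq h2).mul (h3.sq h4)).mul (h5.inv_sq h6)).mul (h7.inv_sq h8)

theorem sends_S {a b c d e : ℝ} (h1 : Sends B a b) (h2 : Sends A b c) (h3 : Sends B d c)
    (h4 : Sends B e d) : Sends (S A B) a e := by
  rw [S_eq]
  exact (h1.mul h2).mul (h3.inv_sq h4)

theorem sends_shifter {a b c d e : ℝ} (h1 : Sends A a b) (h2 : Sends B b c) (h3 : Sends A d c)
    (h4 : Sends A e d) : Sends (A * B * (A ^ 2)⁻¹) a e :=
  (h1.mul h2).mul (h3.inv_sq h4)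

theorem sends_T {a b c d : ℝ} (h1 : Sends (A * B * (A ^ 2)⁻¹) a b) (h2 : Sends (S A B) b c)
    (h3 : Sends (A * B * (A ^ 2)⁻¹) d c) : Sends (T A B) a d := by
  rw [T_eq]
  exact (h1.mul h2).mul h3.inv

/-- `S` fixes a point if `A` and `B` agree at its image under `B`. -/
theorem sends_S_self {t u v : ℝ} (h1 : Sends B t u) (h2 : Sends A u v) (h3 : Sends B u v) :
    Sends (S A B) t t := sends_S h1 h2 h3 h1

theorem sends_T_self {t u : ℝ} (h1 : Sends (A * B * (A ^ 2)⁻¹) t u) (h2 : Sends (S A B) u u) :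
    Sends (T A B) t t := sends_T h1 h2 h1

theorem C_mem {K : Subgroup RHomeo} (hA : A ∈ K) (hB : B ∈ K) : C A B ∈ K := by
  unfold C
  exact mul_mem (mul_mem (mul_mem (pow_mem hA 2) (pow_mem hB 2)) (inv_mem (pow_mem hA 2)))
    (inv_mem (pow_mem hB 2))

theorem S_mem {K : Subgroup RHomeo} (hA : A ∈ K) (hB : B ∈ K) : S A B ∈ K := by
  rw [S_eq]
  exact mul_mem (mul_mem hB hA) (inv_mem (pow_mem hB 2))

theorem T_mem {K : Subgroup RHomeo} (hA : A ∈ K) (hB : B ∈ K) : T A B ∈ K := by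
  rw [T_eq]
  have h := mul_mem (mul_mem hA hB) (inv_mem (pow_mem hA 2))
  exact mul_mem (mul_mem h (S_mem hA hB)) (inv_mem h)

end Word

/-! ### The words at the standard generators -/

theorem sends_x_zero_high {t u : ℝ} (h : 1 ≤ t) (hu : u = t + 1) : Sends (x 0) t u :=
  sends_x_high (by push_cast; linarith) hu

theorem sends_x_zero_low {t u : ℝ} (h : 0 ≤ t) (h1 : t ≤ 1) (hu : u = 2 * t) : Sends (x 0) t u :=
  sends_x_mid (by push_cast; linarith) (by push_cast; linarith) (by push_cast; linarith)

theorem sends_x_one_high {t u : ℝ} (h : 2 ≤ t) (hu : u = t + 1) : Sends (x 1) t u :=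
  sends_x_high (by push_cast; linarith) hu

theorem sends_x_one_mid {t u : ℝ} (h : 1 ≤ t) (h1 : t ≤ 2) (hu : u = 2 * t - 1) :
    Sends (x 1) t u :=
  sends_x_mid (by push_cast; linarith) (by push_cast; linarith) (by push_cast; linarith)

theorem sends_x_one_low {t : ℝ} (h : 0 ≤ t) (h1 : t ≤ 1) : Sends (x 1) t t :=
  sends_x_low h (by push_cast; linarith)

open Word

theorem sends_S_x_low {t : ℝ} (h0 : 0 ≤ t) (h : t ≤ 1 / 4) : Sends (S (x 0) (x 1)) t (2 * t) :=
  sends_S (sends_x_one_low h0 (by linarith)) (sends_x_zero_low h0 (by linarith) rfl)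
    (sends_x_one_low (by linarith) (by linarith)) (sends_x_one_low (by linarith) (by linarith))

/-- From `3/2` on, `x_1` leads into `[2, ∞)`, where `x_0` and `x_1` are the same translation, so
that `S = x_1 x_0 x_1⁻²` cancels. -/
theorem S_x_fixedOn : S (x 0) (x 1) ∈ fixedOn (Set.Ici (3 / 2)) := by
  intro t (h : 3 / 2 ≤ t) h0
  rcases le_total t 2 with h2 | h2
  · exact sends_S_self (sends_x_one_mid (by linarith) h2 rfl)
      (sends_x_zero_high (by linarith) rfl) (sends_x_one_high (by linarith) rfl)
  · exact sends_S_self (sends_x_one_high h2 rfl)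
      (sends_x_zero_high (by linarith) rfl) (sends_x_one_high (by linarith) rfl)

theorem T_x_fixedOn : T (x 0) (x 1) ∈ fixedOn (Set.Ici (3 / 2)) := by
  intro t (h : 3 / 2 ≤ t) h0
  exact sends_T_self (sends_shifter (sends_x_zero_high (by linarith) rfl)
    (sends_x_one_high (by linarith) rfl) (sends_x_zero_high (by linarith) rfl)
    (sends_x_zero_high (by linarith) rfl)) (S_x_fixedOn t h h0)

theorem sends_T_x_low {t : ℝ} (h0 : 0 ≤ t) (h : t ≤ 1 / 4) : Sends (T (x 0) (x 1)) t (2 * t) := by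
  have key : ∀ u : ℝ, 0 ≤ u → u ≤ 1 / 2 →
      Sends (x 0 * x 1 * (x 0 ^ 2)⁻¹) u (u / 2) := fun u hu0 hu =>
    sends_shifter (sends_x_zero_low hu0 (by linarith) rfl)
      (sends_x_one_low (by linarith) (by linarith))
      (sends_x_zero_low hu0 (by linarith) rfl) (sends_x_zero_low (by linarith) (by linarith)
        (by ring))
  refine sends_T (key t h0 (by linarith)) (sends_S_x_low (by linarith) (by linarith)) ?_
  exact (key (2 * t) (by linarith) (by linarith)).congr (by ring)

theorem C_x_fixedOn : C (x 0) (x 1) ∈ fixedOn (Set.Ici 2) := by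
  intro t (h : 2 ≤ t) h0
  exact sends_C (sends_x_zero_high (by linarith) rfl) (sends_x_zero_high (by linarith) rfl)
    (sends_x_one_high (by linarith) rfl) (sends_x_one_high (by linarith) rfl)
    (f := t + 3) (sends_x_zero_high (by linarith) (by linarith))
    (g := t + 2) (sends_x_zero_high (by linarith) (by linarith))
    (h := t + 1) (sends_x_one_high (by linarith) (by linarith))
    (sends_x_one_high (by linarith) (by linarith))

theorem sends_C_x_fourth : Sends (C (x 0) (x 1)) (1 / 4) (1 / 4) :=
  sends_C (b := 1 / 2) (c := 1) (d := 1) (e := 1) (f := 1 / 2) (g := 1 / 4) (h := 1 / 4)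
    (sends_x_zero_low (by norm_num) (by norm_num) (by norm_num))
    (sends_x_zero_low (by norm_num) (by norm_num) (by norm_num))
    (sends_x_one_low (by norm_num) (by norm_num)) (sends_x_one_low (by norm_num) (by norm_num))
    (sends_x_zero_low (by norm_num) (by norm_num) (by norm_num))
    (sends_x_zero_low (by norm_num) (by norm_num) (by norm_num))
    (sends_x_one_low (by norm_num) (by norm_num)) (sends_x_one_low (by norm_num) (by norm_num))

theorem sends_C_x_half : Sends (C (x 0) (x 1)) (1 / 2) (5 / 4) :=
  sends_C (b := 1) (c := 2) (d := 3) (e := 4) (f := 3) (g := 2) (h := 3 / 2)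
    (sends_x_zero_low (by norm_num) (by norm_num) (by norm_num))
    (sends_x_zero_low (by norm_num) (by norm_num) (by norm_num))
    (sends_x_one_high (by norm_num) (by norm_num)) (sends_x_one_high (by norm_num) (by norm_num))
    (sends_x_zero_high (by norm_num) (by norm_num))
    (sends_x_zero_high (by norm_num) (by norm_num))
    (sends_x_one_mid (by norm_num) (by norm_num) (by norm_num))
    (sends_x_one_mid (by norm_num) (by norm_num) (by norm_num))

/-- On `[5/4, 3/2]` the element `C` is `t ↦ t / 2 + 1`. -/
theorem sends_C_x_mid {t : ℝ} (h : 5 / 4 ≤ t) (h' : t ≤ 3 / 2) :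
    Sends (C (x 0) (x 1)) t (t / 2 + 1) := by
  have h1 : 1 ≤ t := by linarith
  exact sends_C (sends_x_zero_high h1 rfl) (sends_x_zero_high (by linarith) rfl)
    (sends_x_one_high (by linarith) rfl) (sends_x_one_high (by linarith) rfl)
    (f := t + 3) (sends_x_zero_high (by linarith) (by linarith))
    (g := t + 2) (sends_x_zero_high (by linarith) (by linarith))
    (h := t + 1) (sends_x_one_high (by linarith) (by linarith))
    (sends_x_one_mid (by linarith) (by linarith) (by linarith))

theorem C_x_increasing : C (x 0) (x 1) ∈ increasing := C_mem (x_increasing 0) (x_increasing 1)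

/-- Two steps suffice, `1/2 ↦ 5/4 ↦ 13/8`, and `C` does not move points back below `3/2` because it
sends `3/2` to `7/4`. -/
theorem exists_sends_C_x_pow (i : ℕ) :
    ∃ u, 3 / 2 ≤ u ∧ Sends (C (x 0) (x 1) ^ (i + 2)) (1 / 2) u := by
  induction i with
  | zero => exact ⟨_, by norm_num, sends_C_x_half.sq (sends_C_x_mid (by norm_num) (by norm_num))⟩
  | succ i ih =>
    obtain ⟨u, hu, h⟩ := ih
    obtain ⟨v, hv⟩ := exists_sends (C (x 0) (x 1)) (show 0 ≤ u by linarith)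
    refine ⟨v, ?_, ?_⟩
    · have := ((sends_C_x_mid (t := 3 / 2) (by norm_num) (by norm_num)).le_iff C_x_increasing
        hv).1 hu
      linarith
    · rw [show i + 1 + 2 = (i + 2) + 1 from rfl, pow_succ]
      exact h.mul hv

theorem sends_pow_self {f : RHomeo} {a : ℝ} (h : Sends f a a) (n : ℕ) : Sends (f ^ n) a a := by
  induction n with
  | zero => exact sends_one h.nonneg
  | succ n ih =>
    rw [pow_succ]
    exact ih.mul h

/-- Conjugating `f⁻¹` by the inverse of a conjugate of `f` by a power of `C` moves its support into
`[0, 1/4]`. -/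
theorem conj_inv_fixedOn {f : RHomeo} (hi : f ∈ increasing) (hf : f ∈ fixedOn (Set.Ici (3 / 2)))
    (h : Sends f (1 / 4) (1 / 2)) (i : ℕ) :
    ((C (x 0) (x 1) ^ (i + 2))⁻¹ * f * C (x 0) (x 1) ^ (i + 2)) * f⁻¹ *
      ((C (x 0) (x 1) ^ (i + 2))⁻¹ * f * C (x 0) (x 1) ^ (i + 2))⁻¹ ∈
      fixedOn (Set.Ici (1 / 4)) := by
  obtain ⟨u, hu, hC⟩ := exists_sends_C_x_pow i
  set c := C (x 0) (x 1) ^ (i + 2) with hc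
  have hs : Sends (c⁻¹ * f * c) (1 / 4) u :=
    ((sends_pow_self sends_C_x_fourth (i + 2)).inv.mul h).mul hC
  have hm : c⁻¹ * f * c ∈ increasing :=
    mul_mem (mul_mem (inv_mem (pow_mem C_x_increasing _)) hi) (pow_mem C_x_increasing _)
  intro t (ht : 1 / 4 ≤ t) h0
  obtain ⟨v, hv⟩ := exists_sends (c⁻¹ * f * c) h0
  -- The conjugate of `f` lifts `[1/4, ∞)` into `[3/2, ∞)`, where `f⁻¹` is trivial.
  have huv : u ≤ v := (hs.le_iff hm hv).1 ht
  exact (hv.mul (hf v (hu.trans huv) hv.nonneg').inv).mul hv.inv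

/-- `S` and `T` have the same germ `t ↦ 2t` at `0`, valid on `[0, 1/4]`. -/
theorem S_inv_mul_T_fixedOn :
    (S (x 0) (x 1))⁻¹ * T (x 0) (x 1) ∈ fixedOn (Set.Iic (1 / 2)) := by
  intro t (h : t ≤ 1 / 2) h0
  have h1 : Sends (S (x 0) (x 1)) (t / 2) t :=
    (sends_S_x_low (by linarith) (by linarith)).congr (by ring)
  have h2 : Sends (T (x 0) (x 1)) (t / 2) t :=
    (sends_T_x_low (by linarith) (by linarith)).congr (by ring)
  exact h1.inv.mul h2

theorem S_inv_mul_T_eq : (S (x 0) (x 1))⁻¹ * T (x 0) (x 1) =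
    x 0 * (x 2 ^ 2 * (x 3)⁻¹ * x 2 * x 4 * (x 3 ^ 2)⁻¹ * (x 1)⁻¹) * (x 0)⁻¹ := by
  have g (n : ℕ) : gen (x 0) (x 1) (n + 1) = x (n + 1) := by
    rw [gen]
    induction n with
    | zero => simp
    | succ n ih =>
      rw [← conj_x (Nat.succ_pos n), ← ih]
      simp only [pow_succ, mul_inv_rev, mul_assoc]
  have e1 : x 1 = x 0 * x 2 * (x 0)⁻¹ := by rw [← x_mul_x zero_lt_one, mul_inv_cancel_right]
  have e2 : x 2 = x 0 * x 3 * (x 0)⁻¹ := by rw [← x_mul_x zero_lt_two, mul_inv_cancel_right]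
  rw [S, T, g 1, g 2, g 3]
  simp only [Nat.reduceAdd]
  have h1 : x 1 ^ 2 = x 0 * x 2 ^ 2 * (x 0)⁻¹ := by rw [e1, conj_pow]
  calc _ = x 1 ^ 2 * (x 2)⁻¹ * x 0 * x 2 * x 4 * (x 3 ^ 2)⁻¹ * (x 1)⁻¹ * (x 0)⁻¹ := by group
    _ = (x 0 * x 2 ^ 2 * (x 0)⁻¹) * (x 0 * x 3 * (x 0)⁻¹)⁻¹ * x 0 * x 2 * x 4 * (x 3 ^ 2)⁻¹ *
        (x 1)⁻¹ * (x 0)⁻¹ := by rw [← h1, ← e2]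
    _ = _ := by group

/-- By `S_inv_mul_T_eq`, `S⁻¹ T` is a conjugate by `x_0` of the element `g` occurring in
`conj_of_relations` for `x_1, x_2, x_3, x_4`. Since `x_1` is the same conjugate of `x_2`, everything
reduces to the value of `g x_2 g⁻¹`. -/
theorem conj_S_inv_mul_T :
    (x 1)⁻¹ * ((S (x 0) (x 1))⁻¹ * T (x 0) (x 1)) * x 1 * ((S (x 0) (x 1))⁻¹ * T (x 0) (x 1))⁻¹ =
      x 1 ^ 2 * (w 1)⁻¹ * (x 1 ^ 2)⁻¹ := by
  have e1 : x 1 = x 0 * x 2 * (x 0)⁻¹ := by rw [← x_mul_x zero_lt_one, mul_inv_cancel_right]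
  have e2 : x 2 = x 0 * x 3 * (x 0)⁻¹ := by rw [← x_mul_x zero_lt_two, mul_inv_cancel_right]
  have key := conj_of_relations (x_mul_x (show 1 < 2 by norm_num))
    (x_mul_x (show 2 < 3 by norm_num))
  have hw : w 1 = x 0 * (x 2 * (x 3)⁻¹) * (x 0)⁻¹ := by
    calc w 1 = (x 0 * x 2 * (x 0)⁻¹) * (x 0 * x 3 * (x 0)⁻¹)⁻¹ := by rw [← e1, ← e2, w]
      _ = _ := by group
  rw [S_inv_mul_T_eq, hw]
  generalize hg : x 2 ^ 2 * (x 3)⁻¹ * x 2 * x 4 * (x 3 ^ 2)⁻¹ * (x 1)⁻¹ = g at key ⊢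
  rw [e1]
  calc _ = x 0 * (x 2)⁻¹ * (g * x 2 * g⁻¹) * (x 0)⁻¹ := by group
    _ = x 0 * x 2 ^ 2 * (x 2 * (x 3)⁻¹)⁻¹ * (x 2 ^ 2)⁻¹ * (x 0)⁻¹ := by rw [key, pow_succ' (x 2) 2]; group
    _ = _ := by rw [conj_pow]; group

/-! ### The words `Z`, `W`, `P`, `Q`, `H`, `K` -/

namespace Word

/-- At the standard generators, `P` agrees with `S⁻¹ T` up to an element that fixes `[1/4, ∞)`. -/
theorem exists_P_x_eq (i : ℕ) : ∃ n ∈ fixedOn (Set.Ici (1 / 4)),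
    P (x 0) (x 1) (i + 2) = n * ((S (x 0) (x 1))⁻¹ * T (x 0) (x 1)) := by
  set s := S (x 0) (x 1)
  set t := T (x 0) (x 1)
  set c := C (x 0) (x 1) ^ (i + 2)
  have hs := conj_inv_fixedOn (S_mem (x_increasing 0) (x_increasing 1)) S_x_fixedOn
    ((sends_S_x_low (by norm_num) le_rfl).congr (by norm_num)) i
  have ht := conj_inv_fixedOn (T_mem (x_increasing 0) (x_increasing 1)) T_x_fixedOn
    ((sends_T_x_low (by norm_num) le_rfl).congr (by norm_num)) i
  have hcomm := commute_of_fixedOn S_inv_mul_T_fixedOn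
    (fixedOn_anti (Set.Ici_subset_Ici.2 (by norm_num : (1 / 4 : ℝ) ≤ 1 / 2)) ht)
  refine ⟨_, mul_mem (inv_mem hs) ht, ?_⟩
  -- In `Z⁻¹ W` the factor `S⁻¹ T` stands between two elements supported in `[0, 1/4]`. It commutes
  -- with the right one, which can thus be moved next to the left one.
  rw [mul_assoc, ← hcomm.eq]
  simp only [P, Z, W, Sig, Theta]
  group

theorem P_x_fixedOn (i : ℕ) : P (x 0) (x 1) (i + 2) ∈ fixedOn (Set.Ici (3 / 2)) := by
  obtain ⟨n, hn, h⟩ := exists_P_x_eq i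
  rw [h]
  exact mul_mem (fixedOn_anti (Set.Ici_subset_Ici.2 (by norm_num)) hn)
    (mul_mem (inv_mem S_x_fixedOn) T_x_fixedOn)

/-- The error term `n` is supported in `[0, 1/4]`, where `x_1` and `S⁻¹ T` are both trivial. It
commutes with both and cancels in `x_1⁻¹ P x_1 P⁻¹`. -/
theorem Q_x_eq (i : ℕ) : Q (x 0) (x 1) (i + 2) = x 1 ^ 2 * (w 1)⁻¹ * (x 1 ^ 2)⁻¹ := by
  obtain ⟨n, hn, h⟩ := exists_P_x_eq i
  rw [← conj_S_inv_mul_T, Q, h]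
  set f := (S (x 0) (x 1))⁻¹ * T (x 0) (x 1)
  have h1 : Commute (x 1) n := commute_of_fixedOn (a := 1)
    (fun t ht h0 => sends_x_one_low h0 ht) (fixedOn_anti (Set.Ici_subset_Ici.2 (by norm_num)) hn)
  have h2 : Commute f n := commute_of_fixedOn S_inv_mul_T_fixedOn
    (fixedOn_anti (Set.Ici_subset_Ici.2 (by norm_num)) hn)
  have h3 : Commute ((x 1)⁻¹ * f * x 1 * f⁻¹) n :=
    ((h1.inv_left.mul_left h2).mul_left h1).mul_left h2.inv_left
  calc _ = (x 1)⁻¹ * n * f * x 1 * f⁻¹ * n⁻¹ := by group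
    _ = n * ((x 1)⁻¹ * f * x 1 * f⁻¹) * n⁻¹ := by rw [h1.inv_left.eq]; group
    _ = _ := by rw [← h3.eq, mul_inv_cancel_right]

theorem H_x_eq (i : ℕ) : H (x 0) (x 1) (i + 2) = (w 1)⁻¹ := by
  rw [H, Q_x_eq]
  group

theorem K_x_eq (i : ℕ) : K (x 0) (x 1) (i + 2) = (y 1)⁻¹ := by
  rw [K, H_x_eq, y_eq]
  group

end Word

/-! ### Values of the modified generators -/

theorem blocks_add {k : ℕ} {r : ℝ} (h : 0 ≤ r) (h' : r < 4) :
    blocks (4 * k + r) = 4 * k + block r := by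
  rw [blocks_eq (k := k) (by push_cast; linarith) (by push_cast; linarith)]
  push_cast
  rw [add_sub_cancel_left]

section Values

variable {b : ℕ} (m : ℕ) (hb : 5 < b)

theorem six_le_cast (hb : 5 < b) : (6 : ℝ) ≤ b := by exact_mod_cast hb

theorem X0Fun_translation {t : ℝ} (h : 1 ≤ t) (h' : t ≤ b - 3 / 2) : X0Fun b m t = t + 1 := by
  unfold X0Fun xFun leftEnd
  push_cast
  split_ifs <;> linarith

theorem X0Fun_high {t : ℝ} (h : b + 4 * m + 2 + 1 / 2 ≤ t) : X0Fun b m t = t + 1 := by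
  have hm : (0 : ℝ) ≤ m := Nat.cast_nonneg m
  rw [X0Fun, if_neg (by linarith), if_neg (by linarith), if_neg (by linarith), rightEnd]
  split_ifs <;> linarith

theorem X0Fun_eighth : X0Fun b m (b + 4 * m + 2 + 1 / 8) = b + 4 * m + 2 + 1 / 2 := by
  have hm : (0 : ℝ) ≤ m := Nat.cast_nonneg m
  rw [X0Fun, if_neg (by linarith), if_neg (by linarith), if_neg (by linarith), rightEnd]
  split_ifs <;> linarith

theorem X0Fun_block {k : ℕ} {r : ℝ} (h : 0 < r) (h' : r < 4) (h2 : 4 * k + r ≤ 4 * m + 2) :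
    X0Fun b m (b + 4 * k + r) = b + 4 * k + block r := by
  have hk : (0 : ℝ) ≤ k := Nat.cast_nonneg k
  rw [X0Fun, if_neg (by linarith), if_neg (by linarith), if_pos (by linarith),
    show b + 4 * k + r - b = 4 * k + r by ring, blocks_add h.le h', ← add_assoc]

theorem X0Fun_three_halves {k : ℕ} (hk : k ≤ m) :
    X0Fun b m (b + 4 * k + 3 / 2) = b + 4 * k + 1 / 2 := by
  have hk' : (k : ℝ) ≤ m := by exact_mod_cast hk
  rw [X0Fun_block m (by norm_num) (by norm_num) (by linarith)]
  norm_num [block]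

theorem X0Fun_five_halves {k : ℕ} (hk : k ≤ m) :
    X0Fun b m (b + 4 * k + 5 / 2) = b + 4 * k + 7 / 2 := by
  rcases hk.eq_or_lt with rfl | hk
  · rw [X0Fun_high k (by linarith)]
    ring
  · have hk' : (k : ℝ) + 1 ≤ m := by exact_mod_cast hk
    rw [X0Fun_block m (by norm_num) (by norm_num) (by linarith)]
    norm_num [block]

theorem X0Fun_neg_three_halves (hb : 5 < b) {k : ℕ} (hk : k ≤ m) :
    X0Fun b m (b + 4 * k - 3 / 2) = b + 4 * k - 1 / 2 := by
  rcases k with _ | k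
  · have := six_le_cast hb
    rw [X0Fun_translation m (by push_cast; linarith) (by push_cast; linarith)]
    ring
  · have h := X0Fun_five_halves (b := b) m (show k ≤ m by omega)
    push_cast
    rw [show (b : ℝ) + 4 * (k + 1) - 3 / 2 = b + 4 * k + 5 / 2 by ring, h]
    ring

theorem X0_increasing : X0 b m hb ∈ increasing := ofFun_increasing _ _ _ _

theorem X1_increasing : X1 b m hb ∈ increasing := ofFun_increasing _ _ _ _

theorem sends_X0 {t u : ℝ} (h : 0 ≤ t) (hu : X0Fun b m t = u) : Sends (X0 b m hb) t u :=
  sends_ofFun _ _ _ h hu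

theorem sends_X1 {t u : ℝ} (h : 0 ≤ t) (hu : X0Fun b m (t - 1) + 1 = u) :
    Sends (X1 b m hb) t u :=
  sends_ofFun _ _ _ h hu

theorem sends_X1_low {t : ℝ} (h : 0 ≤ t) (h' : t ≤ 1) : Sends (X1 b m hb) t t := by
  have := six_le_cast hb
  refine sends_X1 m hb h ?_
  rw [X0Fun, if_pos (by linarith), xFun, if_pos (by push_cast; linarith)]
  ring

theorem sends_X0_translation {t u : ℝ} (h : 1 ≤ t) (h' : t ≤ b - 3 / 2) (hu : u = t + 1) :
    Sends (X0 b m hb) t u :=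
  sends_X0 m hb (by linarith) (by rw [X0Fun_translation m h h', hu])

theorem sends_X1_translation {t u : ℝ} (h : 2 ≤ t) (h' : t ≤ b - 1 / 2) (hu : u = t + 1) :
    Sends (X1 b m hb) t u :=
  sends_X1 m hb (by linarith) (by rw [X0Fun_translation m (by linarith) (by linarith), hu]; ring)

theorem sends_X0_high {t u : ℝ} (h : b + 4 * m + 2 + 1 / 2 ≤ t) (hu : u = t + 1) :
    Sends (X0 b m hb) t u :=
  sends_X0 m hb (by linarith [(Nat.cast_nonneg m : (0 : ℝ) ≤ m), (Nat.cast_nonneg b : (0 : ℝ) ≤ b)]) (by rw [X0Fun_high m h, hu])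

theorem sends_X1_high {t u : ℝ} (h : b + 4 * m + 2 + 3 / 2 ≤ t) (hu : u = t + 1) :
    Sends (X1 b m hb) t u :=
  sends_X1 m hb (by linarith [(Nat.cast_nonneg m : (0 : ℝ) ≤ m), (Nat.cast_nonneg b : (0 : ℝ) ≤ b)]) (by rw [X0Fun_high m (by linarith), hu]; ring)

/-- On `[0, b - 2]` the homeomorphism `X_0` agrees with `x_0`. -/
theorem sends_X0_of_le {t u : ℝ} (ht : t ≤ b - 2) (h : Sends (x 0) t u) :
    Sends (X0 b m hb) t u :=
  sends_X0 m hb h.nonneg (by rw [X0Fun, if_pos ht]; exact (sends_x 0 h.nonneg).unique h)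

/-- On `[0, b - 1]` the homeomorphism `X_1` agrees with `x_1`. -/
theorem sends_X1_of_le {t u : ℝ} (ht : t ≤ b - 1) (h : Sends (x 1) t u) :
    Sends (X1 b m hb) t u := by
  refine sends_X1 m hb h.nonneg ?_
  rw [X0Fun, if_pos (by linarith), h.unique (sends_x 1 h.nonneg)]
  unfold xFun
  push_cast
  split_ifs <;> linarith

/-! ### Comparison on an initial segment -/

/-- `f` agrees with `g` on `[0, N - k]`, and `g` moves the points there to the right by at
most `k`. -/
def Near (N k : ℝ) (f g : RHomeo) : Prop :=
  ∀ s t, s + k ≤ N → Sends g s t → Sends f s t ∧ t ≤ s + k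

/-- The first factor uses up `k` of the available room, the second one `l`. As inverse letters are
also charged `1`, the constant obtained for a word is its length. -/
theorem Near.mul {N k l : ℝ} {f f' g g' : RHomeo} (h : Near N k f g) (h' : Near N l f' g')
    (hl : 0 ≤ l) : Near N (k + l) (f * f') (g * g') := by
  intro s t hs hst
  obtain ⟨u, hu⟩ := exists_sends g hst.nonneg
  obtain ⟨v, hv⟩ := exists_sends g' hu.nonneg'
  obtain ⟨h1, h2⟩ := h s u (by linarith) hu
  obtain ⟨h3, h4⟩ := h' u v (by linarith) hv
  rw [hst.unique (hu.mul hv)]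
  exact ⟨h1.mul h3, by linarith⟩

theorem xFun_bounds (i : ℕ) (t : ℝ) : t ≤ xFun i t ∧ xFun i t ≤ t + 1 := by
  unfold xFun
  constructor <;> split_ifs <;> linarith

theorem near_X0 : Near (b - 2) 1 (X0 b m hb) (x 0) := fun s t hs hst => by
  have := (xFun_bounds 0 s).2
  rw [(sends_x 0 hst.nonneg).unique hst] at this
  exact ⟨sends_X0_of_le m hb (by linarith) hst, this⟩

theorem near_X1 : Near (b - 2) 1 (X1 b m hb) (x 1) := fun s t hs hst => by
  have := (xFun_bounds 1 s).2
  rw [(sends_x 1 hst.nonneg).unique hst] at this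
  exact ⟨sends_X1_of_le m hb (by linarith) hst, this⟩

theorem near_X0_inv : Near (b - 2) 1 (X0 b m hb)⁻¹ (x 0)⁻¹ := fun s t hs hst => by
  have h := hst.inv
  rw [inv_inv] at h
  have := (xFun_bounds 0 t).1
  rw [(sends_x 0 h.nonneg).unique h] at this
  exact ⟨(sends_X0_of_le m hb (by linarith) h).inv, by linarith⟩

theorem near_X1_inv : Near (b - 2) 1 (X1 b m hb)⁻¹ (x 1)⁻¹ := fun s t hs hst => by
  have h := hst.inv
  rw [inv_inv] at h
  have := (xFun_bounds 1 t).1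
  rw [(sends_x 1 h.nonneg).unique h] at this
  exact ⟨(sends_X1_of_le m hb (by linarith) h).inv, by linarith⟩

end Values

/-! ### Commutators that only retain the behaviour near `0` -/

/-- Pairs `(f, g)` such that `g` fixes `[2, ∞)` and `f` agrees with `g` on `[0, 2]`. -/
def agreeing : Subgroup (RHomeo × RHomeo) where
  carrier := {p | p.2 ∈ fixedOn (Set.Ici 2) ∧ ∀ s t, s ≤ 2 → Sends p.2 s t → Sends p.1 s t}
  one_mem' := ⟨one_mem _, fun _ _ _ h => h⟩
  mul_mem' := by
    rintro p q ⟨hp, hp'⟩ ⟨hq, hq'⟩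
    refine ⟨mul_mem hp hq, fun s t hs hst => ?_⟩
    obtain ⟨u, hu⟩ := exists_sends p.2 hst.nonneg
    obtain ⟨v, hv⟩ := exists_sends q.2 hu.nonneg'
    have hu2 : u ≤ 2 := by
      by_contra! hc
      have := hu.inj (hp u hc.le hu.nonneg')
      linarith
    rw [hst.unique (hu.mul hv)]
    exact (hp' s u hs hu).mul (hq' u v hu2 hv)
  inv_mem' := by
    rintro p ⟨hp, hp'⟩
    refine ⟨inv_mem hp, fun s t hs hst => ?_⟩
    have h := hst.inv
    rw [Prod.snd_inv, inv_inv] at h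
    have ht2 : t ≤ 2 := by
      by_contra! hc
      have := h.unique (hp t hc.le h.nonneg)
      linarith
    exact (hp' t s ht2 h).inv

theorem Near.mem_agreeing {N k : ℝ} {f g : RHomeo} (h : Near N k f g) (hN : 2 + k ≤ N)
    (hg : g ∈ fixedOn (Set.Ici 2)) : (f, g) ∈ agreeing :=
  ⟨hg, fun s t hs hst => (h s t (by linarith) hst).1⟩

theorem commutator_mem_agreeing {f g c d : RHomeo} (h : (f, g) ∈ agreeing)
    (h' : (c, d) ∈ agreeing) :
    (f * (c⁻¹ * f * c) * f⁻¹ * (c⁻¹ * f * c)⁻¹, g * (d⁻¹ * g * d) * g⁻¹ * (d⁻¹ * g * d)⁻¹) ∈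
      agreeing := by
  have hmul : ∀ {p q p' q' : RHomeo}, (p, q) ∈ agreeing → (p', q') ∈ agreeing →
      (p * p', q * q') ∈ agreeing := fun hp hq => mul_mem hp hq
  have hinv : ∀ {p q : RHomeo}, (p, q) ∈ agreeing → (p⁻¹, q⁻¹) ∈ agreeing :=
    fun hp => inv_mem hp
  have hconj := hmul (hmul (hinv h') h) h'
  exact hmul (hmul (hmul h hconj) (hinv h)) (hinv hconj)

theorem eq_of_mem_agreeing {f g : RHomeo} (h : (f, g) ∈ agreeing)
    (hf : f ∈ fixedOn (Set.Ici 2)) : f = g := by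
  refine (ext_sends fun s t hst => ?_).symm
  rcases le_total s 2 with hs | hs
  · exact h.2 s t hs hst
  · rw [hst.unique (h.1 s hs hst.nonneg)]
    exact hf s hs hst.nonneg

/-- If `f` is supported in `[0, α'] ∪ [α, β]` and `c` moves `α` to the right of `β`, then `f`
commutes on `[α', ∞)` with its conjugate by `c`. -/
theorem commutator_fixedOn {f c : RHomeo} {α' α β γ : ℝ} (h0 : 0 ≤ α') (h1 : α' ≤ α) (h2 : α ≤ β)
    (hfm : f ∈ increasing) (hcm : c ∈ increasing) (hf : f ∈ fixedOn (Set.Icc α' α))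
    (hf' : f ∈ fixedOn (Set.Ici β)) (hc : Sends c α' α') (hγ : Sends c α γ) (hβ : β ≤ γ) :
    f * (c⁻¹ * f * c) * f⁻¹ * (c⁻¹ * f * c)⁻¹ ∈ fixedOn (Set.Ici α') := by
  -- The conjugate is trivial on the image of `[α', α]` under `c`, which is `[α', γ]` and contains
  -- `[α', β]`.
  have hg : c⁻¹ * f * c ∈ fixedOn (Set.Icc α' β) := fun t ht ht0 => by
    obtain ⟨u, hu⟩ := exists_sends_to c ht0
    have hu1 : α' ≤ u := (hc.le_iff hcm hu).2 ht.1
    have hu2 : u ≤ α := (hu.le_iff hcm hγ).2 (ht.2.trans hβ)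
    exact (hu.inv.mul (hf u ⟨hu1, hu2⟩ hu.nonneg)).mul hu
  have hgm : c⁻¹ * f * c ∈ increasing := mul_mem (mul_mem (inv_mem hcm) hfm) hcm
  have hfβ := hf' β Set.self_mem_Ici (by linarith)
  have hgβ := hg β ⟨h1.trans h2, le_rfl⟩ (by linarith)
  have hfα := hf α' ⟨le_rfl, h1⟩ h0
  intro t (ht : α' ≤ t) ht0
  -- To the left of `β` only `f` acts, and it preserves `[α', β]`; to the right of `β` only the
  -- conjugate acts.
  rcases le_total t β with htβ | htβ
  · obtain ⟨v, hv⟩ := exists_sends f ht0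
    have hv1 : α' ≤ v := (hfα.le_iff hfm hv).1 ht
    have hv2 : v ≤ β := (hv.le_iff hfm hfβ).1 htβ
    exact ((hv.mul (hg v ⟨hv1, hv2⟩ hv.nonneg')).mul hv.inv).mul (hg t ⟨ht, htβ⟩ ht0).inv
  · obtain ⟨v, hv⟩ := exists_sends (c⁻¹ * f * c) ht0
    have hv1 : β ≤ v := (hgβ.le_iff hgm hv).1 htβ
    exact (((hf' t htβ ht0).mul hv).mul (hf' v hv1 hv.nonneg').inv).mul hv.inv

/-! ### The words at the modified generators -/

section Words

variable {b : ℕ} (m : ℕ) (hb : 5 < b)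

open Word

theorem near_S : Near (b - 2) 4 (S (X0 b m hb) (X1 b m hb)) (S (x 0) (x 1)) := by
  rw [S_eq, S_eq, pow_two, pow_two, mul_inv_rev, mul_inv_rev]
  have h := near_X1_inv m hb
  convert ((near_X1 m hb).mul (near_X0 m hb) zero_le_one).mul (h.mul h zero_le_one)
    (by norm_num) using 1
  norm_num

theorem near_C : Near (b - 2) 8 (C (X0 b m hb) (X1 b m hb)) (C (x 0) (x 1)) := by
  simp only [C, pow_two, mul_inv_rev]
  have h0 := near_X0 m hb
  have h1 := near_X1 m hb
  have h2 := near_X0_inv m hb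
  have h3 := near_X1_inv m hb
  convert (((h0.mul h0 zero_le_one).mul (h1.mul h1 zero_le_one) (by norm_num)).mul
    (h2.mul h2 zero_le_one) (by norm_num)).mul (h3.mul h3 zero_le_one) (by norm_num) using 1
  norm_num

theorem near_T : Near (b - 2) 12 (T (X0 b m hb) (X1 b m hb)) (T (x 0) (x 1)) := by
  rw [T_eq, T_eq]
  simp only [pow_two, mul_inv_rev, inv_inv]
  have h0 := near_X0 m hb
  have h1 := near_X1 m hb
  have h2 := near_X0_inv m hb
  have h3 := near_X1_inv m hb
  convert (((h0.mul h1 zero_le_one).mul (h2.mul h2 zero_le_one) (by norm_num)).mul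
    (near_S m hb) (by norm_num)).mul ((h0.mul h0 zero_le_one).mul (h3.mul h2 zero_le_one)
      (by norm_num)) (by norm_num) using 1
  norm_num

/-- The range ends at `b - 5/2` because `X_1` then arrives at `b - 3/2`, the last point up to which
`X_0` is a translation. -/
theorem S_X_fixedOn_Icc : S (X0 b m hb) (X1 b m hb) ∈ fixedOn (Set.Icc 2 (b - 5 / 2)) :=
  fun t ht _ => sends_S_self (sends_X1_translation m hb ht.1 (by linarith [ht.2]) rfl)
    (sends_X0_translation m hb (by linarith [ht.1]) (by linarith [ht.2]) rfl)
    (sends_X1_translation m hb (by linarith [ht.1]) (by linarith [ht.2]) rfl)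

theorem T_X_fixedOn_Icc : T (X0 b m hb) (X1 b m hb) ∈ fixedOn (Set.Icc 2 (b - 5 / 2)) := by
  intro t ht h0
  have h1 : 2 ≤ t := ht.1
  have h2 : t ≤ b - 5 / 2 := ht.2
  exact sends_T_self (sends_shifter (sends_X0_translation m hb (by linarith) (by linarith) rfl)
    (sends_X1_translation m hb (by linarith) (by linarith) rfl)
    (sends_X0_translation m hb (by linarith) (by linarith) rfl)
    (sends_X0_translation m hb (by linarith) (by linarith) rfl)) (S_X_fixedOn_Icc m hb t ht h0)

theorem sends_X1_eighth :
    Sends (X1 b m hb) (b + 4 * m + 2 + 9 / 8) (b + 4 * m + 2 + 3 / 2) := by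
  refine sends_X1 m hb (by positivity) ?_
  rw [show (b : ℝ) + 4 * m + 2 + 9 / 8 - 1 = b + 4 * m + 2 + 1 / 8 by ring, X0Fun_eighth]
  ring

/-- With `ξ = b + 4m + 2`, `X_1` sends `ξ + 9/8` to `ξ + 3/2`, from where on both generators are
translation by `1`. -/
theorem S_X_fixedOn_Ici :
    S (X0 b m hb) (X1 b m hb) ∈ fixedOn (Set.Ici (b + 4 * m + 2 + 9 / 8)) := by
  intro t (ht : (b : ℝ) + 4 * m + 2 + 9 / 8 ≤ t) h0
  obtain ⟨u, hu⟩ := exists_sends (X1 b m hb) h0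
  have h1 := ((sends_X1_eighth m hb).le_iff (X1_increasing m hb) hu).1 ht
  exact sends_S_self hu (sends_X0_high m hb (by linarith) rfl) (sends_X1_high m hb h1 rfl)

theorem T_X_fixedOn_Ici :
    T (X0 b m hb) (X1 b m hb) ∈ fixedOn (Set.Ici (b + 4 * m + 2 + 9 / 8)) := by
  intro t (ht : (b : ℝ) + 4 * m + 2 + 9 / 8 ≤ t) h0
  exact sends_T_self (sends_shifter (sends_X0_high m hb (by linarith) rfl)
    (sends_X1_high m hb (by linarith) rfl)
    (sends_X0_high m hb (by linarith) rfl)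
    (sends_X0_high m hb (by linarith) rfl)) (S_X_fixedOn_Ici m hb t ht h0)

variable {m}

/-- This and the next three lemmas are the stairs climbed by `C`: `X_0`, `X_1`, `X_0⁻¹`, `X_1⁻¹`
pull points up towards `b + 4k`, `b + 4k + 1`, `b + 4k + 2`, `b + 4k + 3` respectively, each gaining
`1` on the lower bound. -/
theorem le_of_sends_X0 {k : ℕ} (hk : k ≤ m) {t u : ℝ} (h : Sends (X0 b m hb) t u)
    (ht : b + 4 * k - 3 / 2 ≤ t) : b + 4 * k - 1 / 2 ≤ u := by
  have := six_le_cast hb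
  exact ((sends_X0 m hb (by linarith [(Nat.cast_nonneg k : (0 : ℝ) ≤ k)])
    (X0Fun_neg_three_halves m hb hk)).le_iff (X0_increasing m hb) h).1 ht

theorem le_of_sends_X1 {k : ℕ} (hk : k ≤ m) {t u : ℝ} (h : Sends (X1 b m hb) t u)
    (ht : b + 4 * k - 1 / 2 ≤ t) : b + 4 * k + 1 / 2 ≤ u := by
  have := six_le_cast hb
  refine ((sends_X1 m hb (t := b + 4 * k - 1 / 2)
    (by linarith [(Nat.cast_nonneg k : (0 : ℝ) ≤ k)]) ?_).le_iff (X1_increasing m hb) h).1 ht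
  rw [show (b : ℝ) + 4 * k - 1 / 2 - 1 = b + 4 * k - 3 / 2 by ring, X0Fun_neg_three_halves m hb hk]
  ring

theorem le_of_sends_X0_inv {k : ℕ} (hk : k ≤ m) {t u : ℝ} (h : Sends (X0 b m hb) t u)
    (hu : b + 4 * k + 1 / 2 ≤ u) : b + 4 * k + 3 / 2 ≤ t :=
  ((sends_X0 m hb (by positivity) (X0Fun_three_halves m hk)).le_iff (X0_increasing m hb) h).2 hu

theorem le_of_sends_X1_inv {k : ℕ} (hk : k ≤ m) {t u : ℝ} (h : Sends (X1 b m hb) t u)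
    (hu : b + 4 * k + 3 / 2 ≤ u) : b + 4 * k + 5 / 2 ≤ t := by
  refine ((sends_X1 m hb (t := b + 4 * k + 5 / 2) (by positivity) ?_).le_iff
    (X1_increasing m hb) h).2 hu
  rw [show (b : ℝ) + 4 * k + 5 / 2 - 1 = b + 4 * k + 3 / 2 by ring, X0Fun_three_halves m hk]
  ring

/-- `C` moves every point of the middle region to the right past the next block. -/
theorem exists_sends_C_X {k : ℕ} (hk : k ≤ m) {t u : ℝ} (h : Sends (X0 b m hb) t u)
    (hu : b + 4 * k - 3 / 2 ≤ u) :
    ∃ v : ℝ, b + 4 * k + 5 / 2 ≤ v ∧ Sends (C (X0 b m hb) (X1 b m hb)) t v := by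
  obtain ⟨p, hp⟩ := exists_sends (X0 b m hb) h.nonneg'
  obtain ⟨q, hq⟩ := exists_sends (X1 b m hb) hp.nonneg'
  obtain ⟨r, hr⟩ := exists_sends (X1 b m hb) hq.nonneg'
  obtain ⟨q', hq'⟩ := exists_sends_to (X0 b m hb) hr.nonneg'
  obtain ⟨p', hp'⟩ := exists_sends_to (X0 b m hb) hq'.nonneg
  obtain ⟨u', hu'⟩ := exists_sends_to (X1 b m hb) hp'.nonneg
  obtain ⟨t', ht'⟩ := exists_sends_to (X1 b m hb) hu'.nonneg
  have h1 := le_of_sends_X0 hb hk hp hu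
  have h2 := le_of_sends_X1 hb hk hq h1
  have h3 := le_of_sends_X1 hb hk hr (by linarith)
  have h4 := le_of_sends_X0_inv hb hk hq' h3
  have h5 := le_of_sends_X0_inv hb hk hp' (by linarith)
  have h6 := le_of_sends_X1_inv hb hk hu' h5
  have h7 := le_of_sends_X1_inv hb hk ht' (by linarith)
  exact ⟨t', h7, sends_C h hp hq hr hq' hp' hu' ht'⟩

theorem exists_sends_C_X_pow (k : ℕ) (hk : k ≤ m) :
    ∃ v : ℝ, b + 4 * k + 5 / 2 ≤ v ∧
      Sends (C (X0 b m hb) (X1 b m hb) ^ (k + 1)) (b - 5 / 2) v := by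
  have hb' := six_le_cast hb
  induction k with
  | zero =>
    rw [zero_add, pow_one]
    exact exists_sends_C_X hb hk (sends_X0_translation m hb (by linarith) (by linarith) rfl)
      (by push_cast; linarith)
  | succ k ih =>
    obtain ⟨v, hv, h⟩ := ih (by omega)
    obtain ⟨u, hu⟩ := exists_sends (X0 b m hb) h.nonneg'
    have hu' := le_of_sends_X0 hb hk hu (by push_cast; linarith)
    obtain ⟨w, hw, hw'⟩ := exists_sends_C_X hb hk hu (by linarith)
    refine ⟨w, hw, ?_⟩
    rw [pow_succ]
    exact h.mul hw'

/-- The first `m + 1` steps pass the blocks `0, …, m` and reach `b + 4m + 5/2`; one more step, taken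
in the right end piece, passes the end of the middle part of the supports of `S` and `T`. This
explains the exponent `i = m + 2`. -/
theorem exists_sends_C_X_pow_last :
    ∃ v : ℝ, b + 4 * m + 2 + 9 / 8 ≤ v ∧
      Sends (C (X0 b m hb) (X1 b m hb) ^ (m + 2)) (b - 5 / 2) v := by
  obtain ⟨v, hv, h⟩ := exists_sends_C_X_pow hb m le_rfl
  have hC : Sends (C (X0 b m hb) (X1 b m hb)) (b + 4 * m + 5 / 2) (b + 4 * m + 2 + 9 / 8) := by
    refine sends_C (sends_X0_high m hb (by linarith) rfl) (sends_X0_high m hb (by linarith) rfl)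
      (sends_X1_high m hb (by linarith) rfl) (sends_X1_high m hb (by linarith) rfl)
      (f := b + 4 * m + 5 / 2 + 3) (sends_X0_high m hb (by linarith) (by linarith))
      (g := b + 4 * m + 5 / 2 + 2) (sends_X0_high m hb (by linarith) (by linarith))
      (h := b + 4 * m + 2 + 3 / 2) (sends_X1_high m hb (by linarith) (by linarith))
      (sends_X1_eighth m hb)
  obtain ⟨w, hw⟩ := exists_sends (C (X0 b m hb) (X1 b m hb)) h.nonneg'
  refine ⟨w, (hC.le_iff (C_mem (X0_increasing m hb) (X1_increasing m hb)) hw).1 hv, ?_⟩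
  rw [pow_succ]
  exact h.mul hw

/-- The commutator of `f` with its conjugate by `C ^ (m + 2)` is local near `0`. -/
theorem commutator_X_eq (hB : 16 ≤ b) {f g : RHomeo} (hfm : f ∈ increasing)
    (hfg : (f, g) ∈ agreeing) (hf : f ∈ fixedOn (Set.Icc 2 (b - 5 / 2)))
    (hf' : f ∈ fixedOn (Set.Ici (b + 4 * m + 2 + 9 / 8))) :
    f * ((C (X0 b m hb) (X1 b m hb) ^ (m + 2))⁻¹ * f * C (X0 b m hb) (X1 b m hb) ^ (m + 2)) *
      f⁻¹ * ((C (X0 b m hb) (X1 b m hb) ^ (m + 2))⁻¹ * f *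
        C (X0 b m hb) (X1 b m hb) ^ (m + 2))⁻¹ =
    g * ((C (x 0) (x 1) ^ (m + 2))⁻¹ * g * C (x 0) (x 1) ^ (m + 2)) *
      g⁻¹ * ((C (x 0) (x 1) ^ (m + 2))⁻¹ * g * C (x 0) (x 1) ^ (m + 2))⁻¹ := by
  have hB' : (16 : ℝ) ≤ b := by exact_mod_cast hB
  have hC : (C (X0 b m hb) (X1 b m hb), C (x 0) (x 1)) ∈ agreeing :=
    (near_C m hb).mem_agreeing (by linarith) C_x_fixedOn
  have hCn : (C (X0 b m hb) (X1 b m hb) ^ (m + 2), C (x 0) (x 1) ^ (m + 2)) ∈ agreeing :=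
    pow_mem hC (m + 2)
  refine eq_of_mem_agreeing (commutator_mem_agreeing hfg hCn) ?_
  obtain ⟨v, hv, h⟩ := exists_sends_C_X_pow_last (m := m) hb
  have hm : (0 : ℝ) ≤ m := Nat.cast_nonneg m
  exact commutator_fixedOn zero_le_two (by linarith) (by linarith) hfm
    (pow_mem (C_mem (X0_increasing m hb) (X1_increasing m hb)) _) hf hf'
    (hCn.2 2 2 le_rfl (sends_pow_self (C_x_fixedOn 2 Set.self_mem_Ici zero_le_two) _)) h hv

theorem Z_X_eq (hB : 16 ≤ b) :
    Z (X0 b m hb) (X1 b m hb) (m + 2) = Z (x 0) (x 1) (m + 2) := by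
  have hB' : (16 : ℝ) ≤ b := by exact_mod_cast hB
  exact commutator_X_eq hb hB (S_mem (X0_increasing m hb) (X1_increasing m hb))
    ((near_S m hb).mem_agreeing (by linarith)
      (fixedOn_anti (Set.Ici_subset_Ici.2 (by norm_num)) S_x_fixedOn))
    (S_X_fixedOn_Icc m hb) (S_X_fixedOn_Ici m hb)

theorem W_X_eq (hB : 16 ≤ b) :
    W (X0 b m hb) (X1 b m hb) (m + 2) = W (x 0) (x 1) (m + 2) := by
  have hB' : (16 : ℝ) ≤ b := by exact_mod_cast hB
  exact commutator_X_eq hb hB (T_mem (X0_increasing m hb) (X1_increasing m hb))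
    ((near_T m hb).mem_agreeing (by linarith)
      (fixedOn_anti (Set.Ici_subset_Ici.2 (by norm_num)) T_x_fixedOn))
    (T_X_fixedOn_Icc m hb) (T_X_fixedOn_Ici m hb)

theorem P_X_eq (hB : 16 ≤ b) :
    P (X0 b m hb) (X1 b m hb) (m + 2) = P (x 0) (x 1) (m + 2) := by
  rw [P, P, Z_X_eq hb hB, W_X_eq hb hB]

theorem Q_X_eq (hB : 16 ≤ b) :
    Q (X0 b m hb) (X1 b m hb) (m + 2) = Q (x 0) (x 1) (m + 2) := by
  have hB' : (16 : ℝ) ≤ b := by exact_mod_cast hB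
  -- `P` is supported in `[0, 3/2]`, where `X_1` and `x_1` agree.
  rw [Q, Q, P_X_eq hb hB, conj_eq_of_fixedOn (P_x_fixedOn m) (A := x 1) (A' := X1 b m hb)]
  exact fun t u ht h => sends_X1_of_le m hb (by linarith) h

theorem H_X_eq (hB : 16 ≤ b) :
    H (X0 b m hb) (X1 b m hb) (m + 2) = H (x 0) (x 1) (m + 2) := by
  have hB' : (16 : ℝ) ≤ b := by exact_mod_cast hB
  -- A bound on the support of `Q` that does not depend on `b` or `m` is enough; `4` is convenient,
  -- not sharp.
  have hQ : Q (x 0) (x 1) (m + 2) ∈ fixedOn (Set.Ici 4) := by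
    rw [Q_x_eq]
    intro t (ht : 4 ≤ t) h0
    have h : Sends (x 1 ^ 2) t (t + 1 + 1) := (sends_x_one_high (by linarith) rfl).sq
      (sends_x_one_high (by linarith) rfl)
    exact (h.mul (w_fixedOn_Ici 1 _ (show ((1 : ℕ) : ℝ) + 2 ≤ t + 1 + 1 by push_cast; linarith)
      (by linarith)).inv).mul h.inv
  rw [H, H, Q_X_eq hb hB, conj_eq_of_fixedOn hQ (A := x 1 ^ 2) (A' := X1 b m hb ^ 2)]
  intro t u ht h
  have hn := ((near_X1 m hb).mul (near_X1 m hb) zero_le_one) t u (by linarith)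
    (by rwa [← pow_two])
  rw [pow_two]
  exact hn.1

theorem K_X_eq (hB : 16 ≤ b) :
    K (X0 b m hb) (X1 b m hb) (m + 2) = K (x 0) (x 1) (m + 2) := by
  have hB' : (16 : ℝ) ≤ b := by exact_mod_cast hB
  have hH : H (x 0) (x 1) (m + 2) ∈ fixedOn (Set.Ici 3) := by
    rw [H_x_eq]
    have h := inv_mem (w_fixedOn_Ici 1)
    norm_num at h
    simpa using h
  have e := conj_eq_of_fixedOn hH (A := (x 1)⁻¹) (A' := (X1 b m hb)⁻¹) fun t u ht h =>
    ((near_X1_inv m hb) t u (by linarith) h).1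
  rw [inv_inv, inv_inv] at e
  rw [K, K, H_X_eq hb hB, e]

end Words

/-! ### Absence of short relations -/

section PingPong

variable {b m : ℕ} (hb : 5 < b)

theorem exists_sends_X0_attract {k : ℕ} (hk : k ≤ m) {p : ℝ} (h : b + 4 * k - 3 / 2 < p)
    (h' : p < b + 4 * k + 3 / 2) :
    ∃ q : ℝ, b + 4 * k - 1 / 2 < q ∧ q < b + 4 * k + 1 / 2 ∧ Sends (X0 b m hb) p q := by
  have hb' := six_le_cast hb
  have hk' : (0 : ℝ) ≤ k := Nat.cast_nonneg k
  obtain ⟨q, hq⟩ := exists_sends (X0 b m hb) (show 0 ≤ p by linarith)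
  exact ⟨q, ((sends_X0 m hb (by linarith) (X0Fun_neg_three_halves m hb hk)).lt_iff
    (X0_increasing m hb) hq).1 h, (hq.lt_iff (X0_increasing m hb)
      (sends_X0 m hb (by linarith) (X0Fun_three_halves m hk))).1 h', hq⟩

theorem exists_sends_X0_repel {k : ℕ} (hk : k ≤ m) {p : ℝ} (h : b + 4 * k + 1 / 2 < p)
    (h' : p < b + 4 * k + 7 / 2) :
    ∃ q : ℝ, b + 4 * k + 3 / 2 < q ∧ q < b + 4 * k + 5 / 2 ∧ Sends (X0 b m hb) q p := by
  have hk' : (0 : ℝ) ≤ b + 4 * k := by positivity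
  obtain ⟨q, hq⟩ := exists_sends_to (X0 b m hb) (show 0 ≤ p by linarith)
  exact ⟨q, ((sends_X0 m hb (by linarith) (X0Fun_three_halves m hk)).lt_iff
    (X0_increasing m hb) hq).2 h, (hq.lt_iff (X0_increasing m hb)
      (sends_X0 m hb (by linarith) (X0Fun_five_halves m hk))).2 h', hq⟩

theorem sends_X1_of_sends_X0 {p q : ℝ} (hp : 0 ≤ p) (h : Sends (X0 b m hb) p q) :
    Sends (X1 b m hb) (p + 1) (q + 1) :=
  sends_X1 m hb (by linarith) (by
    rw [add_sub_cancel_right, (sends_X0 m hb hp rfl).unique h])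

/-- The residue modulo `4`, relative to `b`, of the fixed points that attract a letter. -/
def attractor (l : Fin 2 × Bool) : ℤ := (l.1 : ℕ) + if l.2 then 0 else 2

/-- The homeomorphism denoted by a letter. -/
noncomputable def letter (b m : ℕ) (hb : 5 < b) (l : Fin 2 × Bool) : RHomeo :=
  cond l.2 (![X0 b m hb, X1 b m hb] l.1) (![X0 b m hb, X1 b m hb] l.1)⁻¹

theorem exists_sends_letter (l : Fin 2 × Bool) {k : ℕ} (hk : k ≤ m) {p : ℝ}
    (h : b + 4 * k + attractor l - 3 / 2 < p) (h' : p < b + 4 * k + attractor l + 3 / 2) :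
    ∃ q : ℝ, b + 4 * k + attractor l - 1 / 2 < q ∧ q < b + 4 * k + attractor l + 1 / 2 ∧
      Sends (letter b m hb l) p q := by
  have hb' := six_le_cast hb
  have hk' : (0 : ℝ) ≤ k := Nat.cast_nonneg k
  obtain ⟨j, s⟩ := l
  fin_cases j <;> cases s <;> simp [attractor] at h h' ⊢
  · obtain ⟨q, h1, h2, h3⟩ := exists_sends_X0_repel hb hk (p := p) (by linarith) (by linarith)
    exact ⟨q, by linarith, by linarith, h3.inv⟩
  · obtain ⟨q, h1, h2, h3⟩ := exists_sends_X0_attract hb hk (p := p) (by linarith) (by linarith)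
    exact ⟨q, by linarith, by linarith, h3⟩
  · obtain ⟨q, h1, h2, h3⟩ := exists_sends_X0_repel hb hk (p := p - 1) (by linarith) (by linarith)
    refine ⟨q + 1, by linarith, by linarith, ?_⟩
    have h4 := sends_X1_of_sends_X0 hb h3.nonneg h3
    rw [sub_add_cancel] at h4
    exact h4.inv
  · obtain ⟨q, h1, h2, h3⟩ := exists_sends_X0_attract hb hk (p := p - 1) (by linarith)
      (by linarith)
    refine ⟨q + 1, by linarith, by linarith, ?_⟩
    have h4 := sends_X1_of_sends_X0 hb h3.nonneg h3
    rwa [sub_add_cancel] at h4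

theorem attractor_mem (l : Fin 2 × Bool) : 0 ≤ attractor l ∧ attractor l ≤ 3 := by
  revert l
  decide

/-- The attracting points of a letter form a residue class modulo `4`, and the repelling ones are
opposite. An integer that is not repelling is within `1` of an attracting point, so `p` is within
`3/2` of it, inside the basin that the letter contracts to radius `1/2`. -/
theorem exists_sends_letter_near (l : Fin 2 × Bool) {c : ℤ} {p : ℝ} (hc : b + 1 ≤ c)
    (hc' : c ≤ b + 4 * m + 1) (hl : ¬ 4 ∣ c + 2 - b - attractor l) (hp : |p - c| < 1 / 2) :
    ∃ (c' : ℤ) (q : ℝ), |c' - c| ≤ 1 ∧ 4 ∣ c' - b - attractor l ∧ |q - c'| < 1 / 2 ∧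
      Sends (letter b m hb l) p q := by
  obtain ⟨h0, h3⟩ := attractor_mem l
  -- The bounds on `c` keep the chosen attracting point inside the row of blocks.
  obtain ⟨k, hk, h1, h2⟩ : ∃ k : ℕ, k ≤ m ∧ c - 1 ≤ b + 4 * k + attractor l ∧
      b + 4 * k + attractor l ≤ c + 1 := ⟨((c - b - attractor l + 1) / 4).toNat, by omega⟩
  have h1' : (c : ℝ) - 1 ≤ b + 4 * k + attractor l := by exact_mod_cast h1
  have h2' : (b : ℝ) + 4 * k + attractor l ≤ c + 1 := by exact_mod_cast h2
  rw [abs_lt] at hp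
  obtain ⟨q, hq, hq', h⟩ := exists_sends_letter hb l hk (p := p) (by linarith) (by linarith)
  refine ⟨b + 4 * k + attractor l, q, abs_le.2 ⟨by linarith, by linarith⟩, ⟨k, by ring⟩, ?_, h⟩
  push_cast
  exact abs_lt.2 ⟨by linarith, by linarith⟩

/-- The points repelled by a letter are those attracted by its inverse, and the four letters have
different attracting residues. A letter is therefore dangerous only immediately after its inverse.
-/
theorem attractor_of_reduced {l l' : Fin 2 × Bool} (h : l.1 = l'.1 → l.2 = l'.2) {c : ℤ}
    (hc : 4 ∣ c - b - attractor l) : ¬ 4 ∣ c + 2 - b - attractor l' := by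
  have key : ¬ 4 ∣ attractor l + 2 - attractor l' := by
    clear hc
    revert l l'
    decide
  omega

/-- Ping-pong: the nearby integer drifts by at most `1` per letter, so a margin of the length of the
word on both sides keeps the orbit among the blocks. -/
theorem exists_sends_word (L : List (Fin 2 × Bool)) (hL : FreeGroup.IsReduced L) {c : ℤ} {p : ℝ}
    (hc : b + 1 + L.length ≤ c) (hc' : c ≤ b + 4 * m + 2 - L.length)
    (hl : ∀ l ∈ L.head?, ¬ 4 ∣ c + 2 - b - attractor l) (hp : |p - c| < 1 / 2) :
    ∃ (c' : ℤ) (q : ℝ), (∀ l ∈ L.getLast?, 4 ∣ c' - b - attractor l) ∧ |q - c'| < 1 / 2 ∧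
      Sends (L.map (letter b m hb)).prod p q := by
  induction L generalizing c p with
  | nil =>
    have h1 : (b : ℝ) + 1 ≤ c := by
      simp only [List.length_nil, Nat.cast_zero, add_zero] at hc
      exact_mod_cast hc
    rw [abs_lt] at hp
    have hb' := six_le_cast hb
    exact ⟨c, p, by simp, abs_lt.2 hp, sends_one (by linarith)⟩
  | cons l L ih =>
    rw [List.length_cons] at hc hc'
    push_cast at hc hc'
    obtain ⟨c₁, p₁, h1, h2, h3, h4⟩ := exists_sends_letter_near (m := m) hb l (by omega) (by omega)
      (hl l rfl) hp
    rw [abs_le] at h1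
    have hL' : FreeGroup.IsReduced L := hL.infix (List.suffix_cons l L).isInfix
    obtain ⟨c', q, h5, h6, h7⟩ := ih hL' (c := c₁) (p := p₁) (by omega) (by omega)
      (fun l' hl' => by
        obtain ⟨L', rfl⟩ : ∃ L', L = l' :: L' := by
          cases L with
          | nil => simp at hl'
          | cons a L' => exact ⟨L', by simpa using hl'⟩
        exact attractor_of_reduced (FreeGroup.isReduced_cons_cons.1 hL).1 h2) h3
    have h8 : Sends ((l :: L).map (letter b m hb)).prod p q := by
      rw [List.map_cons, List.prod_cons]
      exact h4.mul h7
    cases L with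
    | nil =>
      have : p₁ = q := (sends_one h4.nonneg').unique h7
      exact ⟨c₁, q, fun l' hl' => by simp at hl'; rwa [← hl'], this ▸ h3, h8⟩
    | cons a L => exact ⟨c', q, fun l' hl' => h5 l' (by simpa using hl'), h6, h8⟩

theorem lift_ne_one (v : FreeGroup (Fin 2)) (hv : v ≠ 1)
    (hl : (v.toWord.length : ℤ) < 2 * (m : ℤ) - 3) :
    FreeGroup.lift ![X0 b m hb, X1 b m hb] v ≠ 1 := by
  intro h
  have hL : FreeGroup.IsReduced v.toWord := FreeGroup.isReduced_toWord
  have hne : v.toWord ≠ [] := fun h' => hv (FreeGroup.toWord_eq_nil_iff.1 h')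
  have hprod : FreeGroup.lift ![X0 b m hb, X1 b m hb] v =
      (v.toWord.map (letter b m hb)).prod := by
    conv_lhs => rw [← FreeGroup.mk_toWord (x := v), FreeGroup.lift_mk]
    rfl
  rw [h] at hprod
  generalize v.toWord = L at *
  -- Among four consecutive integers at most two are excluded: the one repelled by the first letter
  -- and the one attracted by the last. Avoiding the latter makes the final integer differ from `c`.
  obtain ⟨c, hc, hc', hf, hz⟩ : ∃ c : ℤ, (b : ℤ) + 2 * m ≤ c ∧ c ≤ b + 2 * m + 3 ∧
      ¬ 4 ∣ c + 2 - b - attractor (L.head hne) ∧ ¬ 4 ∣ c - b - attractor (L.getLast hne) := by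
    by_contra! hcon
    have h0 := hcon (b + 2 * m) (by omega) (by omega)
    have h1 := hcon (b + 2 * m + 1) (by omega) (by omega)
    have h2 := hcon (b + 2 * m + 2) (by omega) (by omega)
    have h3 := hcon (b + 2 * m + 3) (by omega) (by omega)
    omega
  obtain ⟨c', q, h1, h2, h3⟩ := exists_sends_word hb L hL (m := m) (c := c) (p := c) (by omega)
    (by omega) (fun l hl => by
      rw [List.head?_eq_some_head hne] at hl
      cases hl
      exact hf) (by norm_num)
  have h4 := h1 _ (List.getLast?_eq_some_getLast hne)
  rw [← hprod] at h3
  rw [← (sends_one h3.nonneg).unique h3] at h2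
  have h5 : |c - c'| < 1 := by
    have : |(c : ℝ) - c'| < 1 := h2.trans (by norm_num)
    exact_mod_cast this
  rw [Int.abs_lt_one_iff, sub_eq_zero] at h5
  exact hz (h5 ▸ h4)

end PingPong

/-! ### The sweeping argument -/

/-- A nonempty initial segment of the half line that is preserved by two increasing homeomorphisms
without common fixed points above `a`, and by their inverses, is everything. -/
theorem eq_univ_of_sends {A B : RHomeo} (hA : A ∈ increasing) (hB : B ∈ increasing) {D : Set ℝ}
    {a : ℝ} (ha : 0 ≤ a) (haD : a ∈ D) (hD : ∀ p q, p ≤ q → q ∈ D → p ∈ D)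
    (hAD : ∀ p q, a ≤ p → Sends A p q → (p ∈ D ↔ q ∈ D))
    (hBD : ∀ p q, a ≤ p → Sends B p q → (p ∈ D ↔ q ∈ D))
    (hfix : ∀ t, a ≤ t → Sends A t t → Sends B t t → False) (s : ℝ) : s ∈ D := by
  by_contra hs
  have hbdd : BddAbove D := ⟨s, fun q hq => by
    by_contra! hc
    exact hs (hD s q hc.le hq)⟩
  have hsup : a ≤ sSup D := le_csSup hbdd haD
  have hlt : ∀ q, q < sSup D → q ∈ D := fun q hq => by
    obtain ⟨r, hr, hqr⟩ := exists_lt_of_lt_csSup ⟨a, haD⟩ hq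
    exact hD q r hqr.le hr
  -- The supremum of `D` is fixed by both maps: if one of them moved it, then that map or its
  -- inverse would carry a point of `D` beyond it.
  have key : ∀ E ∈ increasing, (∀ p q, a ≤ p → Sends E p q → (p ∈ D ↔ q ∈ D)) →
      Sends E (sSup D) (sSup D) := by
    intro E hE hED
    obtain ⟨u, hu⟩ := exists_sends E (ha.trans hsup)
    rcases lt_trichotomy u (sSup D) with h | h | h
    · obtain ⟨t, hut, hts⟩ := exists_between h
      obtain ⟨p, hp⟩ := exists_sends_to E (hu.nonneg'.trans hut.le)
      have hsp : sSup D < p := (hu.lt_iff hE hp).2 hut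
      exact absurd (le_csSup hbdd ((hED p t (hsup.trans hsp.le) hp).2 (hlt t hts))) hsp.not_ge
    · rwa [h] at hu
    · obtain ⟨p, hp⟩ := exists_sends_to E (ha.trans hsup)
      obtain ⟨t, hpt, hts⟩ := exists_between ((hp.lt_iff hE hu).2 h)
      have hmem : max t a ∈ D := by
        -- The maximum with `a` is needed because invariance of `D` is only assumed from `a` on.
        rcases max_choice t a with h' | h' <;> rw [h']
        exacts [hlt t hts, haD]
      obtain ⟨q, hq⟩ := exists_sends E (ha.trans (le_max_right t a))
      have hsq : sSup D < q := (hp.lt_iff hE hq).1 (hpt.trans_le (le_max_left t a))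
      exact absurd (le_csSup hbdd ((hED _ q (le_max_right t a) hq).1 hmem)) hsq.not_ge
  exact hfix _ hsup (key A hA hAD) (key B hB hBD)

/-! ### Fixed points of the modified generators -/

theorem block_fixed {r : ℝ} (h : block r = r) : r = 0 ∨ r = 2 ∨ r = 4 := by
  unfold block at h
  split_ifs at h
  · exact Or.inl (by linarith)
  · linarith
  · linarith
  · exact Or.inr (Or.inl (by linarith))
  · linarith
  · linarith
  · exact Or.inr (Or.inr (by linarith))

theorem blocks_fixed {t : ℝ} (h : blocks t = t) : ∃ k : ℤ, t = 2 * k := by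
  obtain ⟨k, hk, hk'⟩ := exists_block t
  rw [blocks_eq hk hk'] at h
  rcases block_fixed (r := t - 4 * k) (by linarith) with h | h | h
  · exact ⟨2 * k, by push_cast; linarith⟩
  · exact ⟨2 * k + 1, by push_cast; linarith⟩
  · exact ⟨2 * k + 2, by push_cast; linarith⟩

theorem X0Fun_fixed {b m : ℕ} {t : ℝ} (h0 : 0 < t) (h : X0Fun b m t = t) :
    ∃ k : ℤ, t = b + 2 * k := by
  unfold X0Fun at h
  split_ifs at h with h1 h2 h3
  · unfold xFun at h
    push_cast at h
    split_ifs at h <;> linarith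
  · unfold leftEnd at h
    refine ⟨0, ?_⟩
    push_cast
    split_ifs at h <;> linarith
  · obtain ⟨k, hk⟩ := blocks_fixed (t := t - b) (by linarith)
    exact ⟨k, by linarith⟩
  · unfold rightEnd at h
    split_ifs at h <;> linarith

/-- A parity obstruction: above `1` the fixed points of `X_1` are those of `X_0` shifted by `1`,
while the latter lie at even distance from `b`. -/
theorem no_common_fixed {b m : ℕ} (hb : 5 < b) {t : ℝ} (h : 1 < t)
    (h0 : Sends (X0 b m hb) t t) (h1 : Sends (X1 b m hb) t t) : False := by
  have e0 := (sends_X0 m hb h0.nonneg rfl).unique h0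
  have e1 := (sends_X1 m hb h1.nonneg rfl).unique h1
  obtain ⟨k, hk⟩ := X0Fun_fixed (by linarith) e0
  obtain ⟨l, hl⟩ := X0Fun_fixed (b := b) (m := m) (t := t - 1) (by linarith) (by linarith)
  have h2 : (2 * k : ℝ) = 2 * l + 1 := by linarith
  have h3 : 2 * k = 2 * l + 1 := by exact_mod_cast h2
  omega

theorem X0_mem_G {b : ℕ} (m : ℕ) (hb : 5 < b) : X0 b m hb ∈ G b m hb :=
  Subgroup.subset_closure (Or.inl rfl)

theorem X1_mem_G {b : ℕ} (m : ℕ) (hb : 5 < b) : X1 b m hb ∈ G b m hb :=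
  Subgroup.subset_closure (Or.inr rfl)

theorem G_le_increasing {b : ℕ} (m : ℕ) (hb : 5 < b) : G b m hb ≤ increasing := by
  rw [G, Subgroup.closure_le]
  rintro g (rfl | rfl)
  exacts [X0_increasing m hb, X1_increasing m hb]

/-- The translates of `(1, 3)` under `G` cover `(0, ∞)`. -/
theorem exists_mem_G_sends {b : ℕ} (m : ℕ) (hb : 5 < b) {t : ℝ} (ht : 0 < t) :
    ∃ g ∈ G b m hb, ∃ s, 1 < s ∧ s < 3 ∧ Sends g s t := by
  set U : Set ℝ := {t | ∃ g ∈ G b m hb, ∃ s, 1 < s ∧ s < 3 ∧ Sends g s t} with hU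
  have hinv : ∀ g ∈ G b m hb, ∀ p q, Sends g p q → (p ∈ U ↔ q ∈ U) := by
    intro g hg p q h
    constructor
    · rintro ⟨f, hf, s, h1, h3, hs⟩
      exact ⟨f * g, mul_mem hf hg, s, h1, h3, hs.mul h⟩
    · rintro ⟨f, hf, s, h1, h3, hs⟩
      exact ⟨f * g⁻¹, mul_mem hf (inv_mem hg), s, h1, h3, hs.mul h.inv⟩
  have hmid : ∀ p : ℝ, 1 < p → p < 3 → p ∈ U := fun p h1 h3 =>
    ⟨1, one_mem _, p, h1, h3, sends_one (by linarith)⟩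
  -- Near `0` the map `X_0` is doubling, so finitely many applications bring a small point into `(1,
  -- 3)`.
  have hlow : ∀ (n : ℕ) (p : ℝ), p < 3 → 1 < 2 ^ n * p → p ∈ U := by
    intro n
    induction n with
    | zero => exact fun p h3 h1 => hmid p (by simpa using h1) h3
    | succ n ih =>
      intro p h3 h1
      rcases lt_or_ge 1 p with hp | hp
      · exact hmid p hp h3
      · have hp0 : 0 < p := pos_of_mul_pos_right (one_pos.trans h1) (by positivity)
        have hb' := six_le_cast hb
        refine (hinv _ (X0_mem_G m hb) p (2 * p) (sends_X0_of_le m hb (by linarith)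
          (sends_x_zero_low hp0.le hp rfl))).2 (ih _ (by linarith) ?_)
        rw [pow_succ] at h1
        linarith
  have hlow' : ∀ p : ℝ, 0 < p → p < 3 → p ∈ U := fun p h0 h3 => by
    obtain ⟨n, hn⟩ := pow_unbounded_of_one_lt (1 / p) one_lt_two
    rw [div_lt_iff₀ h0] at hn
    exact hlow n p h3 hn
  -- The sweeping set consists of the `r` for which all of `(0, r]` is covered; it is invariant
  -- because elements of `G` are increasing and fix `0`.
  have hD : ∀ g ∈ G b m hb, ∀ p q, 2 ≤ p → Sends g p q →
      (p ∈ {r | ∀ t, 0 < t → t ≤ r → t ∈ U} ↔ q ∈ {r | ∀ t, 0 < t → t ≤ r → t ∈ U}) := by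
    intro g hg p q _ h
    have hm := G_le_increasing m hb hg
    have hz : ∀ u v, Sends g u v → (0 < u ↔ 0 < v) := by
      intro u v huv
      obtain ⟨z, hz⟩ := exists_sends_to g le_rfl
      have h00 : Sends g 0 0 := by
        obtain ⟨z', hz'⟩ := exists_sends g le_rfl
        have h1 := (hz'.le_iff hm hz).1 hz.nonneg
        rwa [le_antisymm h1 hz'.nonneg'] at hz'
      exact h00.lt_iff hm huv
    constructor
    · intro hp t ht0 htq
      obtain ⟨s, hs⟩ := exists_sends_to g ht0.le
      exact (hinv g hg s t hs).1 (hp s ((hz s t hs).2 ht0) ((hs.le_iff hm h).2 htq))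
    · intro hq t ht0 htp
      obtain ⟨s, hs⟩ := exists_sends g ht0.le
      exact (hinv g hg t s hs).2 (hq s ((hz t s hs).1 ht0) ((hs.le_iff hm h).1 htp))
  have := eq_univ_of_sends (X0_increasing m hb) (X1_increasing m hb)
    (D := {r | ∀ t, 0 < t → t ≤ r → t ∈ U}) zero_le_two
    (fun t h0 h2 => hlow' t h0 (by linarith)) (fun p q hpq hq t h0 h => hq t h0 (h.trans hpq))
    (hD _ (X0_mem_G m hb)) (hD _ (X1_mem_G m hb))
    (fun s hs h0 h1 => no_common_fixed hb (by linarith) h0 h1) t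
  exact this t ht le_rfl

theorem Ioi_subset_iUnion {b : ℕ} (m : ℕ) (hb : 5 < b) :
    Set.Ioi 0 ⊆ ⋃ g ∈ G b m hb, g.act '' Set.Ioo 1 3 := by
  intro t ht
  obtain ⟨g, hg, _, h1, h3, s, rfl, h⟩ :=
    exists_mem_G_sends m hb (NNReal.coe_pos.2 (Set.mem_Ioi.1 ht))
  exact Set.mem_iUnion₂.2 ⟨g, hg, s, ⟨by exact_mod_cast h1, by exact_mod_cast h3⟩,
    NNReal.coe_injective h⟩

/-! ### The modified generators belong to `F` -/

/-- The formula for `y_i` on `[i, i + 1]`, relative to the point `i`. -/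
noncomputable def yFun (v : ℝ) : ℝ :=
  if v ≤ 1 / 4 then 2 * v else if v ≤ 1 / 2 then v + 1 / 4 else v / 2 + 1 / 2

theorem sends_y (i : ℕ) {v : ℝ} (h : 0 ≤ v) (h' : v ≤ 1) : Sends (y i) (i + v) (i + yFun v) := by
  have hi : (0 : ℝ) ≤ i := Nat.cast_nonneg i
  have h1 : Sends (x i) (i + v) (i + 2 * v) :=
    sends_x_mid (by linarith) (by linarith) (by ring)
  have h2 := sends_w i h1.nonneg'
  have hy : 0 ≤ yFun v ∧ yFun v ≤ 1 := by
    unfold yFun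
    constructor <;> split_ifs <;> linarith
  have h3 : Sends (x i) (i + yFun v) (i + 2 * yFun v) :=
    sends_x_mid (by linarith [hy.1]) (by linarith [hy.2]) (by ring)
  have h4 : wFun (2 * v) = 2 * yFun v := by
    unfold wFun yFun
    split_ifs <;> linarith
  rw [add_sub_cancel_left, h4] at h2
  rw [y_eq]
  exact (h1.mul h2).mul h3.inv

theorem sends_w_add (i : ℕ) {r s : ℝ} (h : 0 ≤ (i : ℝ) + r) (hs : wFun r = s) :
    Sends (w i) (i + r) (i + s) :=
  (sends_w i h).congr (by rw [add_sub_cancel_left, hs])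

theorem wFun_low {r : ℝ} (h : 0 ≤ r) (h' : r ≤ 1 / 2) : wFun r = 2 * r := by
  unfold wFun
  split_ifs <;> linarith

theorem wFun_mid {r : ℝ} (h : 1 / 2 ≤ r) (h' : r ≤ 1) : wFun r = r + 1 / 2 := by
  unfold wFun
  split_ifs <;> linarith

theorem wFun_high {r : ℝ} (h : 1 ≤ r) (h' : r ≤ 2) : wFun r = r / 2 + 1 := by
  unfold wFun
  split_ifs <;> linarith

/-- The formula for `w_i²` on `[i, i + 2]`, relative to the point `i`. -/
noncomputable def wSqFun (r : ℝ) : ℝ :=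
  if r ≤ 1 / 4 then 4 * r else if r ≤ 1 / 2 then 2 * r + 1 / 2
  else if r ≤ 1 then r / 2 + 5 / 4 else r / 4 + 3 / 2

theorem wFun_wFun {r : ℝ} (h : 0 ≤ r) (h' : r ≤ 2) : wFun (wFun r) = wSqFun r := by
  unfold wSqFun
  split_ifs with h1 h2 h3
  · rw [wFun_low h (by linarith), wFun_low (by linarith) (by linarith)]
    ring
  · rw [wFun_low h (by linarith), wFun_mid (by linarith) (by linarith)]
  · rw [wFun_mid (by linarith) h3, wFun_high (by linarith) (by linarith)]
    ring
  · rw [wFun_high (r := r) (by linarith) h', wFun_high (by linarith) (by linarith)]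
    ring

theorem wFun_nonneg {r : ℝ} (h : 0 ≤ r) : 0 ≤ wFun r := by
  unfold wFun
  split_ifs <;> linarith

theorem sends_w_inv_sq (i : ℕ) {r : ℝ} (h : 0 ≤ r) (h' : r ≤ 2) :
    Sends (w i ^ 2)⁻¹ (i + r) (i + block r) := by
  have hi : (0 : ℝ) ≤ i := Nat.cast_nonneg i
  have h0 : 0 ≤ block r := by
    unfold block
    split_ifs <;> linarith
  have h0' : block r ≤ 2 := by
    unfold block
    split_ifs <;> linarith
  have h1 : wFun (wFun (block r)) = r := by
    rw [wFun_wFun h0 h0']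
    unfold block wSqFun
    split_ifs <;> linarith
  have h2 := wFun_nonneg h0
  exact (sends_w_add i (by linarith) h1).inv_sq (sends_w_add i (by linarith) rfl)

theorem sends_w_sq (i : ℕ) {r : ℝ} (h : 0 ≤ r) (h' : r ≤ 2) :
    Sends (w i ^ 2) (i + r) (i + (block (r + 2) - 2)) := by
  have hi : (0 : ℝ) ≤ i := Nat.cast_nonneg i
  have h1 : wFun (wFun r) = block (r + 2) - 2 := by
    rw [wFun_wFun h h']
    unfold block wSqFun
    split_ifs <;> linarith
  have h2 := wFun_nonneg h
  exact (sends_w_add i (by linarith) rfl).sq (sends_w_add i (by linarith) h1)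

theorem sends_block (i : ℕ) {r : ℝ} (h : 0 ≤ r) (h' : r ≤ 4) :
    Sends ((w i ^ 2)⁻¹ * w (i + 2) ^ 2) (i + r) (i + block r) := by
  have hi : (0 : ℝ) ≤ i := Nat.cast_nonneg i
  rcases le_total r 2 with h2 | h2
  · have h1 := sends_w_inv_sq i h h2
    have h3 : block r ≤ 2 := by
      unfold block
      split_ifs <;> linarith
    exact h1.mul (pow_mem (w_fixedOn_Iic (i + 2)) 2 _
      (show (i : ℝ) + block r ≤ (i + 2 : ℕ) by push_cast; linarith) h1.nonneg')
  · refine (inv_mem (pow_mem (w_fixedOn_Ici i) 2) _ (show (i : ℝ) + 2 ≤ i + r by linarith)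
      (by linarith)).mul ?_
    have h1 := sends_w_sq (i + 2) (r := r - 2) (by linarith) (by linarith)
    push_cast at h1
    rw [sub_add_cancel] at h1
    convert h1 using 1 <;> ring

theorem block_element_fixedOn_Iic (i : ℕ) :
    (w i ^ 2)⁻¹ * w (i + 2) ^ 2 ∈ fixedOn (Set.Iic (i : ℝ)) :=
  mul_mem (inv_mem (pow_mem (w_fixedOn_Iic i) 2))
    (pow_mem (fixedOn_anti (Set.Iic_subset_Iic.2 (by push_cast; linarith))
      (w_fixedOn_Iic (i + 2))) 2)

theorem block_element_fixedOn_Ici (i : ℕ) :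
    (w i ^ 2)⁻¹ * w (i + 2) ^ 2 ∈ fixedOn (Set.Ici ((i : ℝ) + 4)) :=
  mul_mem (inv_mem (pow_mem (fixedOn_anti (Set.Ici_subset_Ici.2 (by linarith))
    (w_fixedOn_Ici i)) 2)) (pow_mem (fixedOn_anti (Set.Ici_subset_Ici.2 (by push_cast; linarith))
      (w_fixedOn_Ici (i + 2))) 2)

/-- The left part of `X_0` followed by the first `k` full blocks. -/
noncomputable def partialX0 (b : ℕ) : ℕ → RHomeo
  | 0 => x 0 * (x (b - 1))⁻¹ * y (b - 1)
  | k + 1 => partialX0 b k * ((w (b + 4 * k) ^ 2)⁻¹ * w (b + 4 * k + 2) ^ 2)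

theorem partialX0_mem_F (b k : ℕ) : partialX0 b k ∈ F := by
  induction k with
  | zero => exact mul_mem (mul_mem (x_mem_F _) (inv_mem (x_mem_F _))) (y_mem_F _)
  | succ k ih =>
    exact mul_mem ih (mul_mem (inv_mem (pow_mem (w_mem_F _) 2)) (pow_mem (w_mem_F _) 2))

theorem partialX0_fixedOn {b : ℕ} (hb : 5 < b) (k : ℕ) :
    partialX0 b k ∈ fixedOn (Set.Ici ((b : ℝ) + 4 * k)) := by
  have hb' := six_le_cast hb
  induction k with
  | zero =>
    intro t (ht : (b : ℝ) + 4 * (0 : ℕ) ≤ t) h0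
    have hc : ((b - 1 : ℕ) : ℝ) = b - 1 := by rw [Nat.cast_sub (by omega), Nat.cast_one]
    push_cast at ht
    have h1 : Sends (x (b - 1)) t (t + 1) := sends_x_high (by linarith) rfl
    exact ((sends_x_zero_high (by linarith) rfl).mul h1.inv).mul
      (y_fixedOn_Ici (b - 1) t (by rw [Set.mem_Ici, hc]; linarith) h0)
  | succ k ih =>
    refine mul_mem (fixedOn_anti (Set.Ici_subset_Ici.2 ?_) ih)
      (fixedOn_anti (Set.Ici_subset_Ici.2 ?_) (block_element_fixedOn_Ici (b + 4 * k))) <;>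
    · push_cast
      linarith

theorem X0Fun_four_mul {b m k : ℕ} (hk : k ≤ m) : X0Fun b m (b + 4 * k) = b + 4 * k := by
  rcases k with _ | k
  · rw [X0Fun, if_neg (by push_cast; linarith), if_pos (by push_cast; linarith)]
    rw [show (b : ℝ) + 4 * (0 : ℕ) - (b - 2) = 2 by push_cast; ring, leftEnd_two]
    push_cast
    ring
  · have hk' : (k : ℝ) + 1 ≤ m := by exact_mod_cast hk
    have hk0 : (0 : ℝ) ≤ k := Nat.cast_nonneg k
    rw [X0Fun, if_neg (by push_cast; linarith), if_neg (by push_cast; linarith),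
      if_pos (by push_cast; linarith),
      show (b : ℝ) + 4 * (k + 1 : ℕ) - b = 4 * (k + 1 : ℕ) + 0 by ring,
      blocks_add le_rfl (by norm_num), block_zero, add_zero]

theorem sends_partialX0 {b m : ℕ} (hb : 5 < b) {k : ℕ} (hk : k ≤ m) {t : ℝ} (h0 : 0 ≤ t)
    (ht : t ≤ b + 4 * k) : Sends (partialX0 b k) t (X0Fun b m t) := by
  have hb' := six_le_cast hb
  induction k generalizing t with
  | zero =>
    push_cast at ht
    have hc : ((b - 1 : ℕ) : ℝ) = b - 1 := by rw [Nat.cast_sub (by omega), Nat.cast_one]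
    rcases le_or_gt t (b - 2) with h2 | h2
    · rw [X0Fun, if_pos h2]
      have h1 := sends_x 0 h0
      have h3 : xFun 0 t ≤ (b - 1 : ℕ) := by
        have := (xFun_bounds 0 t).2
        linarith
      exact (h1.mul (x_fixedOn _ _ h3 h1.nonneg').inv).mul (y_fixedOn_Iic _ _ h3 h1.nonneg')
    · rw [X0Fun, if_neg h2.not_ge, if_pos (by linarith)]
      -- On `[b-2, b]`, `x_0 x_{b-1}⁻¹` compresses the interval onto `[b-1, b]` with slope `1/2`;
      -- `y_{b-1}` then has slopes `2, 1, 1/2`, which gives the slopes `1, 1/2, 1/4` of the left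
      -- end.
      have h1 : Sends (x (b - 1)) ((b - 1 : ℕ) + (t + 2 - b) / 2) (t + 1) :=
        sends_x_mid (by linarith) (by linarith) (by rw [hc]; ring)
      refine (((sends_x_zero_high (by linarith) rfl).mul h1.inv).mul
        (sends_y (b - 1) (by linarith) (by linarith))).congr ?_
      rw [hc]
      unfold yFun leftEnd
      split_ifs <;> linarith
  | succ k ih =>
    have ih := fun t => ih (t := t) (by omega)
    rcases le_or_gt t (b + 4 * k) with h1 | h1
    · have h2 := ih t h0 h1
      refine h2.mul (block_element_fixedOn_Iic _ _ ?_ h2.nonneg')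
      have h3 := (X0Fun_strictMono m hb).monotone h1
      rw [X0Fun_four_mul (by omega)] at h3
      rw [Set.mem_Iic]
      push_cast
      exact h3
    · refine (partialX0_fixedOn hb k t h1.le h0).mul ?_
      push_cast at ht
      have h2 := sends_block (b + 4 * k) (r := t - (b + 4 * k)) (by linarith) (by linarith)
      push_cast at h2
      rw [add_sub_cancel] at h2
      refine h2.congr ?_
      rcases ht.lt_or_eq with h3 | h3
      · have hk' : (k : ℝ) + 1 ≤ m := by exact_mod_cast hk
        have h4 := X0Fun_block (b := b) m (k := k) (r := t - (b + 4 * k)) (by linarith)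
          (by linarith) (by linarith)
        rw [add_sub_cancel] at h4
        exact h4.symm
      · have h4 := X0Fun_four_mul (b := b) hk
        push_cast at h4
        rw [← h3] at h4
        rw [h4, h3, show (b : ℝ) + 4 * (k + 1) - (b + 4 * k) = 4 by ring, block_four]
        ring

/-- The factors act one after the other on adjacent intervals. At the right end, `x_ξ w_ξ` with `ξ =
b + 4m + 2` has slopes `4, 2, 1`. -/
theorem X0_eq {b : ℕ} (m : ℕ) (hb : 5 < b) : X0 b m hb = partialX0 b m *
    (w (b + 4 * m) ^ 2)⁻¹ * (x (b + 4 * m + 2) * w (b + 4 * m + 2)) := by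
  have hb' := six_le_cast hb
  refine ext_sends fun t u h => ?_
  have h0 := h.nonneg
  rw [← (sends_X0 m hb h0 rfl).unique h]
  have hξ : ((b + 4 * m + 2 : ℕ) : ℝ) = b + 4 * m + 2 := by push_cast; ring
  have hζ : ((b + 4 * m : ℕ) : ℝ) = b + 4 * m := by push_cast; ring
  have hfix := mul_mem (x_fixedOn (b + 4 * m + 2)) (w_fixedOn_Iic (b + 4 * m + 2))
  rw [hξ] at hfix
  have hfix' := w_fixedOn_Iic (b + 4 * m)
  rw [hζ] at hfix'
  rcases le_or_gt t (b + 4 * m) with h1 | h1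
  · have h2 := sends_partialX0 hb le_rfl h0 h1
    have h3 := (X0Fun_strictMono m hb).monotone h1
    rw [X0Fun_four_mul le_rfl] at h3
    exact (h2.mul (inv_mem (pow_mem hfix' 2) _ h3 h2.nonneg')).mul
      (hfix _ (show X0Fun b m t ≤ _ by linarith) h2.nonneg')
  have hY := partialX0_fixedOn hb m t h1.le h0
  rcases le_or_gt t (b + 4 * m + 2) with h2 | h2
  · have h3 := sends_w_inv_sq (b + 4 * m) (r := t - (b + 4 * m)) (by linarith) (by linarith)
    have h4 := X0Fun_block (b := b) m (k := m) (r := t - (b + 4 * m)) (by linarith)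
          (by linarith) (by linarith)
    rw [add_sub_cancel] at h4
    rw [hζ, add_sub_cancel, ← h4] at h3
    refine (hY.mul h3).mul (hfix _ ?_ h3.nonneg')
    have h5 : block (t - (b + 4 * m)) ≤ 2 := by
      unfold block
      split_ifs <;> linarith
    rw [Set.mem_Iic, h4]
    linarith
  · have h3 := inv_mem (pow_mem (w_fixedOn_Ici (b + 4 * m)) 2) t
      (show ((b + 4 * m : ℕ) : ℝ) + 2 ≤ t by rw [hζ]; exact h2.le) h0
    have h4 := sends_x (b + 4 * m + 2) h0
    refine ((hY.mul h3).mul (h4.mul (sends_w _ h4.nonneg'))).congr ?_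
    have hm : (0 : ℝ) ≤ m := Nat.cast_nonneg m
    rw [X0Fun, if_neg (by linarith), if_neg (by linarith), if_neg (by linarith)]
    unfold xFun
    rw [hξ, if_neg h2.not_ge]
    unfold rightEnd wFun
    split_ifs <;> linarith

theorem X0_mem_F {b : ℕ} (m : ℕ) (hb : 5 < b) : X0 b m hb ∈ F := by
  rw [X0_eq]
  exact mul_mem (mul_mem (partialX0_mem_F b m) (inv_mem (pow_mem (w_mem_F _) 2)))
    (mul_mem (x_mem_F _) (w_mem_F _))

/-! ### Translation by `1` preserves `F` -/

/-- `g` is the conjugate of `f` by the translation by `1`. -/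
def IsShift (f g : RHomeo) : Prop :=
  g ∈ fixedOn (Set.Iic 1) ∧ ∀ s t, Sends f s t → Sends g (s + 1) (t + 1)

theorem IsShift.unique {f g g' : RHomeo} (h : IsShift f g) (h' : IsShift f g') : g = g' := by
  refine ext_sends fun s t hst => ?_
  rcases le_total s 1 with hs | hs
  · rw [hst.unique (h.1 s hs hst.nonneg)]
    exact h'.1 s hs hst.nonneg
  · obtain ⟨u, hu⟩ := exists_sends f (sub_nonneg.2 hs)
    have h1 := h.2 _ _ hu
    have h2 := h'.2 _ _ hu
    rw [sub_add_cancel] at h1 h2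
    rwa [hst.unique h1]

/-- The shift is compatible with products and inverses and takes `x_i` to `x_{i+1}`. -/
theorem exists_isShift_mem_F {f : RHomeo} (hf : f ∈ F) : ∃ g ∈ F, IsShift f g := by
  induction hf using Subgroup.closure_induction with
  | mem f hf =>
    obtain ⟨i, rfl⟩ := hf
    refine ⟨x (i + 1), x_mem_F _, fixedOn_anti (Set.Iic_subset_Iic.2 (by simp)) (x_fixedOn (i + 1)),
      fun s t h => ?_⟩
    rw [h.unique (sends_x i h.nonneg)]
    refine (sends_x (i + 1) (by linarith [h.nonneg])).congr ?_
    unfold xFun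
    push_cast
    split_ifs <;> linarith
  | one => exact ⟨1, one_mem _, one_mem _, fun s t h => by
      rw [h.unique (sends_one h.nonneg)]
      exact sends_one (by linarith [h.nonneg])⟩
  | mul f g _ _ hf hg =>
    obtain ⟨f', hf', h1, h2⟩ := hf
    obtain ⟨g', hg', h3, h4⟩ := hg
    refine ⟨f' * g', mul_mem hf' hg', mul_mem h1 h3, fun s t h => ?_⟩
    obtain ⟨u, hu⟩ := exists_sends f h.nonneg
    obtain ⟨v, hv⟩ := exists_sends g hu.nonneg'
    rw [h.unique (hu.mul hv)]
    exact (h2 _ _ hu).mul (h4 _ _ hv)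
  | inv f _ hf =>
    obtain ⟨f', hf', h1, h2⟩ := hf
    refine ⟨f'⁻¹, inv_mem hf', inv_mem h1, fun s t h => ?_⟩
    have h3 := h.inv
    rw [inv_inv] at h3
    exact (h2 _ _ h3).inv

theorem isShift_X1 {b : ℕ} (m : ℕ) (hb : 5 < b) : IsShift (X0 b m hb) (X1 b m hb) :=
  ⟨fun _ hs h0 => sends_X1_low m hb h0 hs, fun _ _ h => sends_X1_of_sends_X0 hb h.nonneg h⟩

theorem X1_mem_F {b : ℕ} (m : ℕ) (hb : 5 < b) : X1 b m hb ∈ F := by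
  obtain ⟨g, hg, h⟩ := exists_isShift_mem_F (X0_mem_F m hb)
  rwa [(isShift_X1 m hb).unique h]

theorem G_le_F {b : ℕ} (m : ℕ) (hb : 5 < b) : G b m hb ≤ F := by
  rw [G, Subgroup.closure_le]
  rintro g (rfl | rfl)
  exacts [X0_mem_F m hb, X1_mem_F m hb]

/-! ### Elements of `F` with support in a compact interval -/

/-- If a set of generators lies in a subgroup `J` up to powers of `α` and conjugation by large
powers of `α`, then so does the group generated. -/
theorem exists_conj_zpow_mem {Γ : Type*} [Group Γ] {J : Subgroup Γ} {α : Γ} {s : Set Γ}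
    (hs : ∀ g ∈ s, ∃ e m : ℤ, ∀ n, m ≤ n → α ^ n * g * (α ^ (n + e))⁻¹ ∈ J) {g : Γ}
    (hg : g ∈ Subgroup.closure s) :
    ∃ e m : ℤ, ∀ n, m ≤ n → α ^ n * g * (α ^ (n + e))⁻¹ ∈ J := by
  induction hg using Subgroup.closure_induction with
  | mem g hg => exact hs g hg
  | one => exact ⟨0, 0, fun n _ => by simp⟩
  | mul f g _ _ hf hg =>
    obtain ⟨e, m, h⟩ := hf
    obtain ⟨e', m', h'⟩ := hg
    refine ⟨e + e', max m (m' - e), fun n hn => ?_⟩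
    have h3 := mul_mem (h n (le_of_max_le_left hn)) (h' (n + e) (by omega))
    rw [add_assoc] at h3
    convert h3 using 1
    group
  | inv g _ hg =>
    obtain ⟨e, m, h⟩ := hg
    refine ⟨-e, m + e, fun n hn => ?_⟩
    have h3 := inv_mem (h (n - e) (by omega))
    rw [sub_add_cancel] at h3
    convert h3 using 1
    group

theorem zpow_conj_mem {Γ : Type*} [Group Γ] {J : Subgroup Γ} {α : Γ}
    (h : ∀ j ∈ J, α * j * α⁻¹ ∈ J) {j : Γ} (hj : j ∈ J) {n : ℤ} (hn : 0 ≤ n) :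
    α ^ n * j * (α ^ n)⁻¹ ∈ J := by
  obtain ⟨n, rfl⟩ := Int.eq_ofNat_of_zero_le hn
  rw [zpow_natCast]
  induction n with
  | zero => simpa using hj
  | succ n ih =>
    have h1 := h _ (ih (by positivity))
    rw [pow_succ']
    convert h1 using 1
    group

theorem conj_closure_mem {Γ : Type*} [Group Γ] {J : Subgroup Γ} {s : Set Γ} {α : Γ}
    (h : ∀ j ∈ s, α * j * α⁻¹ ∈ J) : ∀ j ∈ Subgroup.closure s, α * j * α⁻¹ ∈ J := by
  have : Subgroup.closure s ≤ J.comap (MulAut.conj α).toMonoidHom := by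
    rw [Subgroup.closure_le]
    exact h
  exact this

/-- An element commuting with `α` that lies in `J` up to powers and conjugates of `α` lies in `J`,
when `α` moves a point fixed by it and by `J`. -/
theorem mem_of_conj_zpow_mem {J : Subgroup RHomeo} {α f : RHomeo} (hα : α ∈ increasing) {t u : ℝ}
    (hu : Sends α t u) (htu : t ≠ u) (hJ : ∀ j ∈ J, Sends j t t) (hft : Sends f t t)
    (hc : Commute α f)
    (h : ∃ e m : ℤ, ∀ n, m ≤ n → α ^ n * f * (α ^ (n + e))⁻¹ ∈ J) : f ∈ J := by
  obtain ⟨e, m, h⟩ := h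
  have h1 := h m le_rfl
  -- Since `f` commutes with `α`, the conjugation disappears and only `f α^{-e}` is left. Its value
  -- at `t` forces `e = 0`.
  have hfe : α ^ m * f * (α ^ (m + e))⁻¹ = f * (α ^ e)⁻¹ := by
    rw [(hc.zpow_left m).eq]
    group
  rw [hfe] at h1
  have h2 : Sends (α ^ e) t t := by
    have h3 := hft.inv.mul (hJ _ h1)
    rw [inv_mul_cancel_left] at h3
    simpa using h3.inv
  have he : e = 0 := by
    rcases htu.lt_or_gt with h3 | h3
    · exact eq_zero_of_sends_zpow hα hu h3 h2
    · have h4 : Sends α⁻¹ u u → False := fun h4 => by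
        have h5 := h4.inv
        rw [inv_inv] at h5
        exact htu (hu.inj h5)
      obtain ⟨v, hv⟩ := exists_sends α⁻¹ hu.nonneg
      have h5 : t < v := (hu.inv.lt_iff (inv_mem hα) hv).1 h3
      have h6 : Sends (α⁻¹ ^ (-e)) t t := by simpa using h2
      simpa using eq_zero_of_sends_zpow (inv_mem hα) hv h5 h6
  rw [he] at h1
  simpa using h1

theorem x_mem_of_le {K : Subgroup RHomeo} {i : ℕ} (h : x i ∈ K) (h' : x (i + 1) ∈ K) {j : ℕ}
    (hij : i ≤ j) : x j ∈ K := by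
  induction j, hij using Nat.le_induction with
  | base => exact h
  | succ j hij ih =>
    rcases hij.eq_or_lt with rfl | hlt
    · exact h'
    · rw [← conj_x hlt]
      exact mul_mem (mul_mem (inv_mem h) ih) h

/-- An element of `F` that fixes `[0, 2]` is generated by `x_1` and `x_2`. -/
theorem mem_closure_x_of_fixedOn {f : RHomeo} (hf : f ∈ F) (h : f ∈ fixedOn (Set.Iic 2)) :
    f ∈ Subgroup.closure {x 1, x 2} := by
  set J := Subgroup.closure {x 1, x 2} with hJ
  have h1 : x 1 ∈ J := Subgroup.subset_closure (Or.inl rfl)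
  have h2 : x 2 ∈ J := Subgroup.subset_closure (Or.inr rfl)
  have hw := w_fixedOn_Ici 0
  norm_num at hw
  have hcomm : Commute (w 0) (x 2) := (commute_of_fixedOn (x_fixedOn 2) (by simpa using hw)).symm
  -- Only one inclusion is needed, since the exponents used below are nonnegative.
  have hconj : ∀ j ∈ J, (w 0)⁻¹ * j * ((w 0)⁻¹)⁻¹ ∈ J := conj_closure_mem (by
    rintro j (rfl | rfl)
    · have : (w 0)⁻¹ * x 1 * ((w 0)⁻¹)⁻¹ = x 1 * x 2 * (x 1)⁻¹ := by
        rw [← conj_x zero_lt_one, w]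
        group
      rw [this]
      exact mul_mem (mul_mem h1 h2) (inv_mem h1)
    · rw [hcomm.inv_left.eq, mul_inv_cancel_right]
      exact h2)
  have hgen : f ∈ Subgroup.closure {x 0, x 1} := by
    have : F ≤ Subgroup.closure {x 0, x 1} := by
      rw [F, Subgroup.closure_le]
      rintro _ ⟨i, rfl⟩
      exact x_mem_of_le (Subgroup.subset_closure (Or.inl rfl))
        (Subgroup.subset_closure (Or.inr rfl)) (Nat.zero_le i)
    exact this hf
  have hJfix : J ≤ fixedOn (Set.Iic 1) := by
    rw [hJ, Subgroup.closure_le]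
    rintro j (rfl | rfl)
    · simpa using x_fixedOn 1
    · exact fixedOn_anti (Set.Iic_subset_Iic.2 (by norm_num)) (x_fixedOn 2)
  -- The test point `1` is fixed by `f` and by `J`, while `w_0⁻¹` moves it to `1/2`.
  refine mem_of_conj_zpow_mem (α := (w 0)⁻¹) (inv_mem (F_le_increasing (w_mem_F 0)))
    (t := 1) (u := 1 / 2) ?_ (by norm_num)
    (fun j hj => hJfix hj 1 Set.self_mem_Iic zero_le_one) (h 1 (by norm_num) zero_le_one)
    (commute_of_fixedOn h (by simpa using hw)).symm.inv_left (exists_conj_zpow_mem ?_ hgen)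
  · have := (sends_w 0 (t := 1 / 2) (by norm_num)).inv
    norm_num [wFun] at this ⊢
    exact this
  · rintro g (rfl | rfl)
    -- As `x_0 = w_0 x_1`, one factor `α = w_0⁻¹` is absorbed, leaving `x_1` conjugated by `α ^ (n -
    -- 1)`.
    · refine ⟨-1, 1, fun n hn => ?_⟩
      convert zpow_conj_mem hconj h1 (n := n - 1) (by omega) using 1
      rw [show x 0 = w 0 * x 1 by rw [w, inv_mul_cancel_right]]
      group
    · refine ⟨0, 0, fun n hn => ?_⟩
      rw [add_zero]
      exact zpow_conj_mem hconj h1 hn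

/-- The product `w_i w_{i+1} ⋯ w_{N-1}` telescopes. -/
theorem x_mul_inv_mem {K : Subgroup RHomeo} {i N : ℕ} (h : i ≤ N)
    (hw : ∀ j, i ≤ j → j < N → w j ∈ K) : x i * (x N)⁻¹ ∈ K := by
  induction N, h using Nat.le_induction with
  | base => simp
  | succ N h ih =>
    have h1 := mul_mem (ih fun j hj hjN => hw j hj (by omega)) (hw N h (by omega))
    rwa [w, mul_assoc, inv_mul_cancel_left] at h1

/-- An element of `F` that fixes `[0, 2]` and `[N + 1, ∞)` is generated by `w_1, …, w_{N+1}` and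
`y_{N+1}`. -/
theorem mem_of_w_mem_of_fixedOn {K : Subgroup RHomeo} {N : ℕ} (hN : 1 ≤ N)
    (hw : ∀ j, 1 ≤ j → j ≤ N + 1 → w j ∈ K) (hy : y (N + 1) ∈ K) {f : RHomeo} (hf : f ∈ F)
    (h : f ∈ fixedOn (Set.Iic 2)) (h' : f ∈ fixedOn (Set.Ici ((N + 1 : ℕ) : ℝ))) : f ∈ K := by
  set s : Set RHomeo := w '' Set.Icc 1 (N + 1) ∪ {y (N + 1)} with hs
  set J := Subgroup.closure s with hJ
  have hJK : J ≤ K := by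
    rw [hJ, Subgroup.closure_le]
    rintro _ (⟨j, hj, rfl⟩ | rfl)
    exacts [hw j hj.1 hj.2, hy]
  have hwJ : ∀ j, 1 ≤ j → j ≤ N + 1 → w j ∈ J := fun j h1 h2 =>
    Subgroup.subset_closure (Or.inl ⟨j, ⟨h1, h2⟩, rfl⟩)
  have hyJ : y (N + 1) ∈ J := Subgroup.subset_closure (Or.inr rfl)
  -- Conjugation by `x_{N+1}` fixes `w_j` for `j < N`, sends `w_N` to `w_N y_{N+1}⁻¹` and `w_{N+1}`
  -- to `y_{N+1}`, and acts on `y_{N+1}` like `w_{N+1}`, because `x_{N+1} = w_{N+1} x_{N+2}` and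
  -- `x_{N+2}` commutes with `y_{N+1}`.
  have hconj : ∀ j ∈ J, x (N + 1) * j * (x (N + 1))⁻¹ ∈ J := conj_closure_mem (by
    rintro _ (⟨j, ⟨h1, h2⟩, rfl⟩ | rfl)
    · rcases Nat.lt_trichotomy j N with h3 | rfl | h3
      · have hc : Commute (w j) (x (N + 1)) := by
          have hj : (j : ℝ) + 2 ≤ (N + 1 : ℕ) := by exact_mod_cast (by omega : j + 2 ≤ N + 1)
          exact (commute_of_fixedOn (x_fixedOn (N + 1))
            (fixedOn_anti (Set.Ici_subset_Ici.2 hj) (w_fixedOn_Ici j))).symm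
        rw [← hc.eq, mul_inv_cancel_right]
        exact hwJ j h1 h2
      · have : x (j + 1) * w j * (x (j + 1))⁻¹ = w j * (y (j + 1))⁻¹ := by
          rw [w, ← mul_assoc, x_mul_x (Nat.lt_succ_self j), y, pow_two]
          group
        rw [this]
        exact mul_mem (hwJ j h1 h2) (inv_mem hyJ)
      · obtain rfl : j = N + 1 := by omega
        rw [← y_eq]
        exact hyJ
    · have hc : Commute (x (N + 2)) (y (N + 1)) := by
        have h1 := y_fixedOn_Ici (N + 1)
        refine commute_of_fixedOn (x_fixedOn (N + 2)) ?_
        convert h1 using 3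
        push_cast
        ring
      have : x (N + 1) * y (N + 1) * (x (N + 1))⁻¹ =
          w (N + 1) * y (N + 1) * (w (N + 1))⁻¹ := by
        calc _ = x (N + 1) * ((x (N + 2))⁻¹ * (x (N + 2) * y (N + 1))) * (x (N + 1))⁻¹ := by group
          _ = _ := by rw [hc.eq, w]; group
      rw [this]
      exact mul_mem (mul_mem (hwJ _ (by omega) le_rfl) hyJ) (inv_mem (hwJ _ (by omega) le_rfl)))
  have hJfix : J ≤ fixedOn (Set.Ici ((N + 1 : ℕ) + 2 : ℝ)) := by
    rw [hJ, Subgroup.closure_le]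
    rintro _ (⟨j, hj, rfl⟩ | rfl)
    · have hj : (j : ℝ) ≤ (N + 1 : ℕ) := by exact_mod_cast hj.2
      exact fixedOn_anti (Set.Ici_subset_Ici.2 (by linarith)) (w_fixedOn_Ici j)
    · exact fixedOn_anti (Set.Ici_subset_Ici.2 (by linarith)) (y_fixedOn_Ici (N + 1))
  have hN0 : (0 : ℝ) ≤ (N + 1 : ℕ) := Nat.cast_nonneg _
  -- The test point is `N + 3`: it lies to the right of the supports of `f` and `J`, and `x_{N+1}`
  -- translates it.
  refine hJK (mem_of_conj_zpow_mem (α := x (N + 1)) (x_increasing _) (t := (N + 1 : ℕ) + 2)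
    (sends_x_high (by linarith) rfl) (by linarith)
    (fun j hj => hJfix hj _ Set.self_mem_Ici (by linarith))
    (h' _ (by rw [Set.mem_Ici]; linarith) (by linarith))
    (commute_of_fixedOn (x_fixedOn _) h')
    (exists_conj_zpow_mem ?_ (mem_closure_x_of_fixedOn hf h)))
  have hx : ∀ i, 1 ≤ i → i ≤ N + 1 → ∃ e m : ℤ, ∀ n, m ≤ n →
      x (N + 1) ^ n * x i * (x (N + 1) ^ (n + e))⁻¹ ∈ J := fun i h1 h2 => by
    refine ⟨1, 0, fun n hn => ?_⟩
    convert zpow_conj_mem hconj (x_mul_inv_mem h2 fun j hij hj => hwJ j (h1.trans hij) hj.le) hn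
      using 1
    group
  rintro g (rfl | rfl)
  exacts [hx 1 le_rfl (by omega), hx 2 (by omega) (by omega)]

/-! ### Generation of `F` -/

section Generation

variable {b : ℕ} (m : ℕ) (hb : 5 < b)

open Word in
theorem Word.H_mem {K : Subgroup RHomeo} {A B : RHomeo} (hA : A ∈ K) (hB : B ∈ K) (i : ℕ) :
    Word.H A B i ∈ K := by
  have hC := pow_mem (C_mem hA hB) i
  have hcomm : ∀ f ∈ K, f * ((C A B ^ i)⁻¹ * f * C A B ^ i) * f⁻¹ *
      ((C A B ^ i)⁻¹ * f * C A B ^ i)⁻¹ ∈ K := fun f hf => by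
    have h := mul_mem (mul_mem (inv_mem hC) hf) hC
    exact mul_mem (mul_mem (mul_mem hf h) (inv_mem hf)) (inv_mem h)
  have hP : P A B i ∈ K :=
    mul_mem (inv_mem (hcomm _ (S_mem hA hB))) (hcomm _ (T_mem hA hB))
  have hQ : Q A B i ∈ K := mul_mem (mul_mem (mul_mem (inv_mem hB) hP) hB) (inv_mem hP)
  exact mul_mem (mul_mem (inv_mem (pow_mem hB 2)) hQ) (pow_mem hB 2)

theorem w_one_mem_G (hB : 16 ≤ b) : w 1 ∈ G b m hb := by
  rw [← inv_mem_iff, ← Word.H_x_eq m, ← H_X_eq hb hB]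
  exact Word.H_mem (X0_mem_G m hb) (X1_mem_G m hb) _

theorem y_one_mem_G (hB : 16 ≤ b) : y 1 ∈ G b m hb := by
  rw [← inv_mem_iff, ← Word.K_x_eq m, ← K_X_eq hb hB]
  exact mul_mem (mul_mem (X1_mem_G m hb) (Word.H_mem (X0_mem_G m hb) (X1_mem_G m hb) _))
    (inv_mem (X1_mem_G m hb))

theorem conj_mem_G {f : RHomeo} {a : ℝ} (hf : f ∈ fixedOn (Set.Ici a)) (ha : a ≤ b - 2)
    (h : f ∈ G b m hb) : (x 0)⁻¹ * f * x 0 ∈ G b m hb := by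
  rw [conj_eq_of_fixedOn hf (A := x 0) (A' := X0 b m hb)
    fun t u ht h => sends_X0_of_le m hb (ht.trans ha) h]
  exact mul_mem (mul_mem (inv_mem (X0_mem_G m hb)) h) (X0_mem_G m hb)

/-- Conjugation by `x_0` raises the index, and `X_0` may replace `x_0` as long as the support of the
conjugated element stays in `[0, b - 2]`. -/
theorem w_y_mem_G (hB : 16 ≤ b) {i : ℕ} (h : 1 ≤ i) (hi : i + 3 ≤ b) :
    w i ∈ G b m hb ∧ y i ∈ G b m hb := by
  induction i, h using Nat.le_induction with
  | base => exact ⟨w_one_mem_G m hb hB, y_one_mem_G m hb hB⟩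
  | succ i h ih =>
    obtain ⟨h1, h2⟩ := ih (by omega)
    have hi' : (i : ℝ) + 4 ≤ b := by exact_mod_cast (by omega : i + 4 ≤ b)
    rw [← conj_w h, ← conj_y h]
    exact ⟨conj_mem_G m hb (w_fixedOn_Ici i) (by linarith) h1,
      conj_mem_G m hb (y_fixedOn_Ici i) (by linarith) h2⟩

theorem mem_G_of_fixedOn_six (hB : 16 ≤ b) {f : RHomeo} (hf : f ∈ F)
    (h : f ∈ fixedOn (Set.Iic 2)) (h' : f ∈ fixedOn (Set.Ici 6)) : f ∈ G b m hb :=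
  mem_of_w_mem_of_fixedOn (N := 5) (by norm_num)
    (fun j h1 h2 => (w_y_mem_G m hb hB h1 (by omega)).1)
    (w_y_mem_G m hb hB (by norm_num) (by omega)).2 hf h (by exact_mod_cast h')

/-- An element of `G` that fixes `2` transports the elements of `F` supported in
`[2, p]`. -/
theorem fixedOn_transport {g : RHomeo} (hg : g ∈ G b m hb) (h2 : Sends g 2 2) {p q : ℝ}
    (hpq : Sends g p q)
    (hp : ∀ f ∈ F, f ∈ fixedOn (Set.Iic 2) → f ∈ fixedOn (Set.Ici p) → f ∈ G b m hb) :
    ∀ f ∈ F, f ∈ fixedOn (Set.Iic 2) → f ∈ fixedOn (Set.Ici q) → f ∈ G b m hb := by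
  intro f hf hf2 hfq
  have hm := G_le_increasing m hb hg
  -- The conjugate must again be an element of `F`; here the inclusion of `G` in `F` is used.
  have hgF := G_le_F m hb hg
  have h : g * f * g⁻¹ ∈ G b m hb := by
    refine hp _ (mul_mem (mul_mem hgF hf) (inv_mem hgF)) (fun t ht h0 => ?_) fun t ht h0 => ?_
    · obtain ⟨u, hu⟩ := exists_sends g h0
      exact (hu.mul (hf2 u ((hu.le_iff hm h2).1 ht) hu.nonneg')).mul hu.inv
    · obtain ⟨u, hu⟩ := exists_sends g h0
      exact (hu.mul (hfq u ((hpq.le_iff hm hu).1 ht) hu.nonneg')).mul hu.inv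
  have h3 := mul_mem (mul_mem (inv_mem hg) h) hg
  convert h3 using 1
  group

/-- All elements of `F` supported in a compact interval to the right of `2` belong to `G`. -/
theorem mem_G_of_fixedOn (hB : 16 ≤ b) (q : ℝ) : ∀ f ∈ F, f ∈ fixedOn (Set.Iic 2) →
    f ∈ fixedOn (Set.Ici q) → f ∈ G b m hb := by
  have hB' : (16 : ℝ) ≤ b := by exact_mod_cast hB
  -- Both `X_0` and `X_1` send `2` to `3`, and `h` brings `3` back to `2` without moving points
  -- beyond `4`. Thus `X_0 h` and `X_1 h` fix `2` and, from `6` on, have only those fixed points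
  -- that `X_0` and `X_1` have.
  set h : RHomeo := (w 2)⁻¹ * (w 1)⁻¹
  have hG : h ∈ G b m hb := mul_mem (inv_mem (w_y_mem_G m hb hB (by norm_num) (by omega)).1)
    (inv_mem (w_y_mem_G m hb hB (by norm_num) (by omega)).1)
  have h32 : Sends h 3 2 := by
    have h1 := sends_w 2 (t := 5 / 2) (by norm_num)
    have h2 := sends_w 1 (t := 2) (by norm_num)
    norm_num [wFun] at h1 h2
    exact h1.inv.mul h2.inv
  have hfix : h ∈ fixedOn (Set.Ici 4) :=
    mul_mem (inv_mem (fixedOn_anti (Set.Ici_subset_Ici.2 (by norm_num)) (w_fixedOn_Ici 2)))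
      (inv_mem (fixedOn_anti (Set.Ici_subset_Ici.2 (by norm_num)) (w_fixedOn_Ici 1)))
  have h0 : Sends (X0 b m hb) 2 3 := sends_X0_translation m hb (by norm_num) (by linarith)
    (by norm_num)
  have h1 : Sends (X1 b m hb) 2 3 := sends_X1_translation m hb le_rfl (by linarith)
    (by norm_num)
  have hm := G_le_increasing m hb
  have hX : ∀ g ∈ G b m hb, Sends g 4 5 → ∀ t, 6 ≤ t → Sends (g * h) t t →
      Sends g t t := by
    intro g hg h45 t ht hgt
    obtain ⟨u, hu⟩ := exists_sends g hgt.nonneg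
    have h5 := (h45.le_iff (hm hg) hu).1 (by linarith)
    rwa [← hgt.unique (hu.mul (hfix u (show 4 ≤ u by linarith) hu.nonneg'))] at hu
  have hD : ∀ g ∈ G b m hb, Sends g 2 3 → ∀ p q, 6 ≤ p → Sends (g * h) p q →
      ((∀ f ∈ F, f ∈ fixedOn (Set.Iic 2) → f ∈ fixedOn (Set.Ici p) → f ∈ G b m hb) ↔
        ∀ f ∈ F, f ∈ fixedOn (Set.Iic 2) → f ∈ fixedOn (Set.Ici q) → f ∈ G b m hb) := by
    intro g hg hg2 p q _ hpq
    have h22 := hg2.mul h32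
    exact ⟨fixedOn_transport m hb (mul_mem hg hG) h22 hpq,
      fixedOn_transport m hb (inv_mem (mul_mem hg hG)) h22.inv hpq.inv⟩
  refine eq_univ_of_sends (A := X0 b m hb * h) (B := X1 b m hb * h)
    (D := {q | ∀ f ∈ F, f ∈ fixedOn (Set.Iic 2) → f ∈ fixedOn (Set.Ici q) → f ∈ G b m hb})
    (hm (mul_mem (X0_mem_G m hb) hG)) (hm (mul_mem (X1_mem_G m hb) hG)) (a := 6) (by norm_num)
    (fun f hf h2 h6 => mem_G_of_fixedOn_six m hb hB hf h2 h6)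
    (fun p q hpq hq f hf h2 hp => hq f hf h2 (fixedOn_anti (Set.Ici_subset_Ici.2 hpq) hp))
    (hD _ (X0_mem_G m hb) h0) (hD _ (X1_mem_G m hb) h1) (fun t ht ht0 ht1 => ?_) q
  exact no_common_fixed hb (by linarith)
    (hX _ (X0_mem_G m hb) (sends_X0_translation m hb (by norm_num) (by linarith)
      (by norm_num)) t ht ht0)
    (hX _ (X1_mem_G m hb) (sends_X1_translation m hb (by norm_num) (by linarith)
      (by norm_num)) t ht ht1)

/-- `X_n` and `x_n`, for `n = 0, 1`, agree on `[0, 2]` and far to the right, so `x_n X_n⁻¹` is one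
of the elements already known to be in `G`. -/
theorem F_le_G (hB : 16 ≤ b) : F ≤ G b m hb := by
  have hB' : (16 : ℝ) ≤ b := by exact_mod_cast hB
  have h0 : x 0 ∈ G b m hb := by
    have h := mem_G_of_fixedOn m hb hB (b + 4 * m + 2 + 1 / 2) (x 0 * (X0 b m hb)⁻¹)
      (mul_mem (x_mem_F 0) (inv_mem (X0_mem_F m hb)))
      (fun t (ht : t ≤ 2) h0 => (sends_x 0 h0).mul
        (sends_X0_of_le m hb (by linarith) (sends_x 0 h0)).inv)
      (fun t (ht : (b : ℝ) + 4 * m + 2 + 1 / 2 ≤ t) _ => by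
        have hm : (0 : ℝ) ≤ m := Nat.cast_nonneg m
        exact (sends_x_zero_high (by linarith) rfl).mul (sends_X0_high m hb ht rfl).inv)
    simpa using mul_mem h (X0_mem_G m hb)
  have h1 : x 1 ∈ G b m hb := by
    have h := mem_G_of_fixedOn m hb hB (b + 4 * m + 2 + 3 / 2) (x 1 * (X1 b m hb)⁻¹)
      (mul_mem (x_mem_F 1) (inv_mem (X1_mem_F m hb)))
      (fun t (ht : t ≤ 2) h0 => (sends_x 1 h0).mul
        (sends_X1_of_le m hb (by linarith) (sends_x 1 h0)).inv)
      (fun t (ht : (b : ℝ) + 4 * m + 2 + 3 / 2 ≤ t) _ => by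
        have hm : (0 : ℝ) ≤ m := Nat.cast_nonneg m
        exact (sends_x_one_high (by linarith) rfl).mul (sends_X1_high m hb ht rfl).inv)
    simpa using mul_mem h (X1_mem_G m hb)
  rw [F, Subgroup.closure_le]
  rintro _ ⟨i, rfl⟩
  exact x_mem_of_le h0 h1 (Nat.zero_le i)

theorem G_eq_F (hB : 16 ≤ b) : G b m hb = F := le_antisymm (G_le_F m hb) (F_le_G m hb hB)

end Generation

end ThompsonF

theorem mainTheorem2 :
    ∃ B : ℕ, ∀ (b : ℕ) (hb : 5 < b), B ≤ b → ∀ m : ℕ, 1 ≤ m →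
      (ThompsonF.Word.Z (ThompsonF.X0 b m hb) (ThompsonF.X1 b m hb) (m + 2) =
          ThompsonF.Word.Z (ThompsonF.x 0) (ThompsonF.x 1) (m + 2) ∧
        ThompsonF.Word.W (ThompsonF.X0 b m hb) (ThompsonF.X1 b m hb) (m + 2) =
          ThompsonF.Word.W (ThompsonF.x 0) (ThompsonF.x 1) (m + 2) ∧
        ThompsonF.Word.P (ThompsonF.X0 b m hb) (ThompsonF.X1 b m hb) (m + 2) =
          ThompsonF.Word.P (ThompsonF.x 0) (ThompsonF.x 1) (m + 2) ∧
        ThompsonF.Word.Q (ThompsonF.X0 b m hb) (ThompsonF.X1 b m hb) (m + 2) =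
          ThompsonF.Word.Q (ThompsonF.x 0) (ThompsonF.x 1) (m + 2) ∧
        ThompsonF.Word.H (ThompsonF.X0 b m hb) (ThompsonF.X1 b m hb) (m + 2) =
          ThompsonF.Word.H (ThompsonF.x 0) (ThompsonF.x 1) (m + 2) ∧
        ThompsonF.Word.K (ThompsonF.X0 b m hb) (ThompsonF.X1 b m hb) (m + 2) =
          ThompsonF.Word.K (ThompsonF.x 0) (ThompsonF.x 1) (m + 2)) ∧
      (ThompsonF.Word.H (ThompsonF.X0 b m hb) (ThompsonF.X1 b m hb) (m + 2) = (ThompsonF.w 1)⁻¹ ∧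
        ThompsonF.Word.K (ThompsonF.X0 b m hb) (ThompsonF.X1 b m hb) (m + 2) = (ThompsonF.y 1)⁻¹) ∧
      (∀ v : FreeGroup (Fin 2), v ≠ 1 → (v.toWord.length : ℤ) < 2 * (m : ℤ) - 3 →
        FreeGroup.lift ![ThompsonF.X0 b m hb, ThompsonF.X1 b m hb] v ≠ 1) ∧
      Set.Ioi 0 ⊆ ⋃ g ∈ ThompsonF.G b m hb, g.act '' Set.Ioo 1 3 ∧
      ThompsonF.G b m hb = ThompsonF.F := by
  -- The value `16` comes from `T`, handled as a word of `12` letters: agreement on `[0, 2]`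
  -- requires `2 + 12 ≤ b - 2`.
  refine ⟨16, fun b hb hB m _ => ⟨⟨ThompsonF.Z_X_eq hb hB, ThompsonF.W_X_eq hb hB,
    ThompsonF.P_X_eq hb hB, ThompsonF.Q_X_eq hb hB, ThompsonF.H_X_eq hb hB,
    ThompsonF.K_X_eq hb hB⟩, ⟨?_, ?_⟩, ThompsonF.lift_ne_one hb,
    ThompsonF.Ioi_subset_iUnion m hb, ThompsonF.G_eq_F m hb hB⟩⟩
  · rw [ThompsonF.H_X_eq hb hB, ThompsonF.Word.H_x_eq]
  · rw [ThompsonF.K_X_eq hb hB, ThompsonF.Word.K_x_eq]
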